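/- Let $n,m$ be positive integers and let $A=(A_1,\dots,A_m)$ be complex $n\times n$ matrices, not all zero. Let $P_n$ be the space of positive definite Hermitian $n\times n$ matrices with the Riemannian distance $d(x,y)=\|\log(x^{-1/2}yx^{-1/2})\|_F$, let $P_n\times P_n$ carry the $\ell^2$-product distance, and let $$f_A(x,y)=n\log\sum_{k=1}^m \operatorname{tr}(xA_kyA_k^\dagger)\qquad (x,y\in P_n).$$ For a Hadamard space $X$, let $CX^\infty$ be the set of constant-speed rays $c:[0,\infty)\to X$ modulo the relation "$d(c(t),c'(t))$ is bounded", and write $c(\infty)$ for the class of $c$. The norm $\|p\|$ of a class is the speed of its rays, $X^\infty=\{u:\|u\|=1\}$, and $\langle p,q\rangle=\|p\|\,\|q\|\cos\angle(p,q)$, where $\angle(p,q)=\lim_{t,t'\to\infty}$ of the comparison angle at $x$ of $c(t),c'(t')$, for rays $c,c'$ issuing from a common point $x$ with $c(\infty)=p$, $c'(\infty)=q$. For $f:X\to\mathbb R$ let $f^\infty(p)=\lim_{t\to\infty}(f(c(t))-f(c(0)))/t$ with $c(\infty)=p$, and for $h:CX^\infty\to\mathbb R\cup\{\infty\}$ let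 $B(h)=\{p\in CX^\infty:\langle u,p\rangle\le h(u)\ \forall u\in X^\infty\}$. For $\alpha\in\mathbb R^n$ and $g\in GL(n,\mathbb C)$ let $\alpha\cdot[g]\in CP_n^\infty$ be the class of the ray $t\mapsto g\,e^{t\operatorname{diag}\alpha}g^\dagger$. A subspace $X\subseteq\mathbb C^n$ of dimension $k$ is regarded as the point $(1,\dots,1,0,\dots,0)\cdot[g]$ ($k$ ones) of $CP_n^\infty$, where the first $k$ columns of $g$ span $X$. Let $\mathcal S_A$ be the set of pairs $(X,Y)$ of subspaces of $\mathbb C^n$ with $u^\dagger A_kv=0$ for all $u\in X$, $v\in Y$, $k\in[m]$. The map sending $(c(\infty),c'(\infty))$ to the class of $t\mapsto(c(t),c'(t))$ is a bijection $CP_n^\infty\times CP_n^\infty\to C(P_n\times P_n)^\infty$, by which the two sets are identified. (1) For all $\alpha,\beta\in\mathbb R^n$ and $g,h\in GL(n,\mathbb C)$, the recession function of $f_A$ at $(p,q)=(\alpha\cdot[g],\beta\cdot[h])$ exists, as the same limit along every ray in the class $(p,q)$, and $$f_A^\infty(p,q)=n\max\{\alpha_i+\beta_j : i,j\in[n],\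 (g^\dagger A_kh)_{ij}\ne0\text{ for some }k\in[m]\}.$$ (2) $B(f_A^\infty)$ is the set of all $(p,q)\in CP_n^\infty\times CP_n^\infty$ with $$\langle\mathbb C^n,p\rangle=\langle\mathbb C^n,q\rangle=n,\qquad \langle X,p\rangle+\langle Y,q\rangle\le n\quad\text{for all }(X,Y)\in\mathcal S_A .$$ -/

import Mathlib

open Filter Topology Matrix
open scoped NNReal ComplexOrder

noncomputable section

/-! ### Rays, the boundary cone, angles and recession functions of a space with a distance -/

/-- A constant-speed ray: a map `c : [0, ∞) → X` with `d (c s, c t) = r |s - t|` for some `r ≥ 0`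
(a geodesic ray is the case `r = 1`). -/
@[ext] structure Ray (X : Type*) [Dist X] where
  toFun : ℝ≥0 → X
  exists_speed : ∃ r : ℝ, 0 ≤ r ∧ ∀ s t : ℝ≥0, dist (toFun s) (toFun t) = r * |(s : ℝ) - (t : ℝ)|

instance {X : Type*} [Dist X] : CoeFun (Ray X) (fun _ => ℝ≥0 → X) := ⟨Ray.toFun⟩

/-- Two rays are asymptotic if their distance stays bounded. -/
def Ray.Asymptotic {X : Type*} [Dist X] (c c' : Ray X) : Prop :=
  ∃ K : ℝ, ∀ t : ℝ≥0, dist (c t) (c' t) ≤ K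

/-- The Euclidean cone `C X^∞` over the boundary at infinity: the constant-speed rays modulo the
equivalence relation "asymptotic". The class of the rays of speed `0` is the apex, and the
classes of the rays of speed `1` form the boundary `X^∞`. -/
def BoundaryCone (X : Type*) [Dist X] : Type _ := Quot (Ray.Asymptotic (X := X))

namespace BoundaryCone

variable {X Y : Type*} [Dist X] [Dist Y]

/-- The class `c(∞)` of a ray. -/
def mk (c : Ray X) : BoundaryCone X := Quot.mk _ c

/-- The norm `‖p‖`: the speed of the rays in the class `p`. -/
def norm (p : BoundaryCone X) : ℝ := dist ((Quot.out p) 0) ((Quot.out p) 1)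

end BoundaryCone

/-- The comparison angle at `x` of the triangle `x, y, z`. -/
def comparisonAngle {X : Type*} [Dist X] (x y z : X) : ℝ :=
  Real.arccos ((dist x y ^ 2 + dist x z ^ 2 - dist y z ^ 2) / (2 * dist x y * dist x z))

namespace BoundaryCone

variable {X Y : Type*} [Dist X] [Dist Y]

/-- `θ` is the limit, as `t, t' → ∞`, of the comparison angles at `x` of `c t` and `c' t'`, for
some rays `c, c'` in the classes `p, q` that issue from a common point `x`. -/
def IsAngle (p q : BoundaryCone X) (θ : ℝ) : Prop :=
  ∃ c c' : Ray X, mk c = p ∧ mk c' = q ∧ c 0 = c' 0 ∧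
    Tendsto (fun s : ℝ≥0 × ℝ≥0 => comparisonAngle (c 0) (c s.1) (c' s.2))
      (atTop ×ˢ atTop) (𝓝 θ)

/-- The angle `∠(p, q)` at infinity. In a Hadamard space it exists, and it does not depend on
the choice of the point `x` and of the rays; nor does it depend on the speeds of the rays, as
long as they are positive. -/
def angle (p q : BoundaryCone X) : ℝ := Classical.epsilon (IsAngle p q)

/-- The inner product `⟨p, q⟩ = ‖p‖ ‖q‖ cos ∠(p, q)` on the boundary cone. -/
def inner (p q : BoundaryCone X) : ℝ := p.norm * q.norm * Real.cos (angle p q)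

/-- The recession function `f^∞(p) = lim_{t → ∞} (f (c t) - f (c 0)) / t`, `c(∞) = p`. -/
def recession (f : X → ℝ) (p : BoundaryCone X) : EReal :=
  limUnder atTop (fun t : ℝ≥0 =>
    (((f ((Quot.out p) t) - f ((Quot.out p) 0)) / (t : ℝ) : ℝ) : EReal))

/-- The set `B(h) = {p ∈ C X^∞ | ⟨u, p⟩ ≤ h u for all u ∈ X^∞}`. -/
def B (h : BoundaryCone X → EReal) : Set (BoundaryCone X) :=
  {p | ∀ u : BoundaryCone X, u.norm = 1 → ((inner u p : ℝ) : EReal) ≤ h u}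

end BoundaryCone

/-! ### Products -/

theorem Ray.dist_self {X : Type*} [Dist X] (c : Ray X) (t : ℝ≥0) : dist (c t) (c t) = 0 := by
  obtain ⟨r, -, h⟩ := c.exists_speed
  simp [h]

theorem l2_dist {X Y : Type*} [Dist X] [Dist Y] (a b : X) (a' b' : Y) :
    dist (WithLp.toLp 2 (a, a')) (WithLp.toLp 2 (b, b')) =
      √(dist a b ^ 2 + dist a' b' ^ 2) := by
  rw [WithLp.prod_dist_eq_add (by norm_num)]
  simp [Real.sqrt_eq_rpow]

/-- The ray `t ↦ (c t, c' t)` in the `ℓ²`-product. -/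
def Ray.pair {X Y : Type*} [Dist X] [Dist Y] (c : Ray X) (c' : Ray Y) :
    Ray (WithLp 2 (X × Y)) where
  toFun t := WithLp.toLp 2 (c t, c' t)
  exists_speed := by
    obtain ⟨r, hr, h⟩ := c.exists_speed
    obtain ⟨r', hr', h'⟩ := c'.exists_speed
    refine ⟨√(r ^ 2 + r' ^ 2), Real.sqrt_nonneg _, fun s t => ?_⟩
    rw [l2_dist, h, h', ← Real.sqrt_sq (abs_nonneg ((s : ℝ) - t)),
      ← Real.sqrt_mul (by positivity), Real.sqrt_sq (abs_nonneg _)]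
    congr 1
    ring

/-! ### The symmetric space of positive definite Hermitian matrices -/

/-- The space `P_n` of positive definite Hermitian `n × n` matrices. -/
def PDMat (n : ℕ) : Type := {x : Matrix (Fin n) (Fin n) ℂ // x.PosDef}

/-- The Frobenius norm `√(∑ |M i j|²)`. -/
def frobNorm {n : ℕ} (M : Matrix (Fin n) (Fin n) ℂ) : ℝ := √(∑ i, ∑ j, ‖M i j‖ ^ 2)

/-- The distance `d(x, y) = ‖log (x^{-1/2} y x^{-1/2})‖_F` of `P_n`, which is the distance of the
Riemannian metric `⟨H, H'⟩_x = tr (x⁻¹ H x⁻¹ H')`. -/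
instance PDMat.instDist (n : ℕ) : Dist (PDMat n) where
  dist x y := frobNorm (cfc Real.log ((cfc Real.sqrt x.1)⁻¹ * y.1 * (cfc Real.sqrt x.1)⁻¹))

theorem PDMat.dist_nonneg {n : ℕ} (x y : PDMat n) : 0 ≤ dist x y := Real.sqrt_nonneg _

/-- `e^{diag α}` -/
def expDiag {n : ℕ} (α : Fin n → ℝ) : Matrix (Fin n) (Fin n) ℂ :=
  diagonal (fun i => ((Real.exp (α i) : ℝ) : ℂ))

theorem posDef_expDiag {n : ℕ} (α : Fin n → ℝ) : (expDiag α).PosDef := by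
  unfold expDiag
  rw [Matrix.posDef_diagonal_iff]
  intro i
  exact_mod_cast Real.exp_pos _

theorem expDiag_mul {n : ℕ} (α β : Fin n → ℝ) : expDiag α * expDiag β = expDiag (α + β) := by
  unfold expDiag
  rw [diagonal_mul_diagonal]
  congr 1
  ext i
  simp [Complex.exp_add]

theorem expDiag_zero {n : ℕ} : expDiag (0 : Fin n → ℝ) = 1 := by
  simp [expDiag]

theorem expDiag_conjTranspose {n : ℕ} (α : Fin n → ℝ) : (expDiag α)ᴴ = expDiag α :=
  (posDef_expDiag α).isHermitian

/-- The point `g e^{diag α} g†` of the flat `F(g)`. -/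
def PDMat.flat {n : ℕ} (g : GL (Fin n) ℂ) (α : Fin n → ℝ) : PDMat n :=
  ⟨(g : Matrix (Fin n) (Fin n) ℂ) * expDiag α * (g : Matrix (Fin n) (Fin n) ℂ)ᴴ, by
    have h := (Matrix.IsUnit.posDef_star_right_conjugate_iff (x := expDiag α) g.isUnit).2
      (posDef_expDiag α)
    simpa [star_eq_conjTranspose] using h⟩

theorem cfc_log_expDiag {n : ℕ} (α : Fin n → ℝ) :
    cfc Real.log (expDiag α) = diagonal (fun i => ((α i : ℝ) : ℂ)) := by
  have hD : (expDiag α).IsHermitian := (posDef_expDiag α).isHermitian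
  let s : Finset ℝ := Finset.univ.image fun i => Real.exp (α i)
  let q : Polynomial ℝ := Lagrange.interpolate s id Real.log
  have hq : ∀ i, q.eval (Real.exp (α i)) = α i := fun i => by
    have := Lagrange.eval_interpolate_at_node (s := s) (v := id) Real.log
      (Set.injOn_id _) (i := Real.exp (α i)) (by simp [s])
    exact this.trans (Real.log_exp _)
  have hspec : ∀ r ∈ spectrum ℝ (expDiag α), ∃ i, r = Real.exp (α i) := by
    intro r hr
    have h2 : (r : ℂ) ∈ spectrum ℂ (expDiag α) := by
      simpa using spectrum.algebraMap_mem (R := ℝ) ℂ hr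
    rw [expDiag, spectrum_diagonal] at h2
    obtain ⟨i, hi⟩ := h2
    exact ⟨i, (Complex.ofReal_injective hi).symm⟩
  have h1 : cfc Real.log (expDiag α) = cfc (fun r => q.eval r) (expDiag α) := by
    refine cfc_congr fun r hr => ?_
    obtain ⟨i, rfl⟩ := hspec r hr
    simp [hq]
  rw [h1]
  refine (cfc_polynomial q (expDiag α) hD).trans ?_
  have h3 : expDiag α = Matrix.diagonalAlgHom ℝ (fun i => ((Real.exp (α i) : ℝ) : ℂ)) := rfl
  rw [h3, Polynomial.aeval_algHom_apply]
  have h4 : Polynomial.aeval (fun i => ((Real.exp (α i) : ℝ) : ℂ)) q =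
      fun i => ((α i : ℝ) : ℂ) := by
    ext i
    refine (Polynomial.aeval_algHom_apply (Pi.evalAlgHom ℝ (fun _ : Fin n => ℂ) i) _ q).symm.trans ?_
    change Polynomial.aeval (algebraMap ℝ ℂ (Real.exp (α i))) q = _
    rw [Polynomial.aeval_algebraMap_apply]
    simp [Polynomial.aeval_def, hq, Polynomial.eval₂_id]
  rw [h4]
  rfl

theorem cfc_unitary_conj {n : ℕ} (f : ℝ → ℝ) (W M : Matrix (Fin n) (Fin n) ℂ)
    (hW : W * Wᴴ = 1) (hM : M.IsHermitian) :
    cfc f (W * M * Wᴴ) = W * cfc f M * Wᴴ := by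
  have hW' : W ∈ unitary (Matrix (Fin n) (Fin n) ℂ) := by
    rw [Unitary.mem_iff]
    exact ⟨mul_eq_one_comm.1 hW, hW⟩
  have hcont : ∀ s : Set ℝ, s.Finite → ContinuousOn f s := fun s hs => hs.continuousOn f
  have hfin : (spectrum ℝ M).Finite := Matrix.finite_real_spectrum
  have h := StarAlgHomClass.map_cfc (S := ℝ)
    (Unitary.conjStarAlgAut ℝ (Matrix (Fin n) (Fin n) ℂ) ⟨W, hW'⟩) f M (hcont _ hfin)
    (by
      change Continuous fun x => W * x * star W
      fun_prop)
    hM (by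
      change (W * M * Wᴴ).IsHermitian
      exact Matrix.isHermitian_mul_mul_conjTranspose W hM)
  simpa [Unitary.conjStarAlgAut_apply, star_eq_conjTranspose] using h.symm

theorem frobNorm_unitary_conj {n : ℕ} (W M : Matrix (Fin n) (Fin n) ℂ) (hW : W * Wᴴ = 1) :
    frobNorm (W * M * Wᴴ) = frobNorm M := by
  have key : ∀ N : Matrix (Fin n) (Fin n) ℂ, ∑ i, ∑ j, ‖N i j‖ ^ 2 = (trace (N * Nᴴ)).re := by
    intro N
    simp only [trace, diag_apply, mul_apply, conjTranspose_apply, Complex.re_sum]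
    refine Finset.sum_congr rfl fun i _ => Finset.sum_congr rfl fun j _ => ?_
    rw [Complex.star_def, Complex.mul_conj, Complex.ofReal_re, Complex.normSq_eq_norm_sq]
  have hW' : Wᴴ * W = 1 := mul_eq_one_comm.1 hW
  unfold frobNorm
  rw [key, key]
  congr 2
  calc trace (W * M * Wᴴ * (W * M * Wᴴ)ᴴ) = trace (W * M * (Wᴴ * W) * (Mᴴ * Wᴴ)) := by
        simp only [conjTranspose_mul, conjTranspose_conjTranspose, Matrix.mul_assoc]
    _ = trace (W * (M * Mᴴ) * Wᴴ) := by rw [hW']; simp only [Matrix.mul_assoc, Matrix.one_mul]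
    _ = trace (M * Mᴴ) := by rw [trace_mul_cycle, hW', Matrix.one_mul]

theorem PDMat.sqrt_facts {n : ℕ} (x : PDMat n) :
    IsUnit (cfc Real.sqrt x.1) ∧ (cfc Real.sqrt x.1)ᴴ = cfc Real.sqrt x.1 ∧
      cfc Real.sqrt x.1 * cfc Real.sqrt x.1 = x.1 := by
  have hx := x.2
  have hsa : IsSelfAdjoint x.1 := hx.isHermitian
  have hsq : cfc Real.sqrt x.1 * cfc Real.sqrt x.1 = x.1 := by
    rw [← cfc_mul Real.sqrt Real.sqrt x.1]
    conv_rhs => rw [← cfc_id ℝ x.1]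
    refine cfc_congr fun r hr => ?_
    have : 0 ≤ r := by
      rw [hx.isHermitian.spectrum_real_eq_range_eigenvalues] at hr
      obtain ⟨i, rfl⟩ := hr
      exact (hx.eigenvalues_pos i).le
    simp [Real.mul_self_sqrt this]
  refine ⟨?_, ?_, hsq⟩
  · have : IsUnit (cfc Real.sqrt x.1 * cfc Real.sqrt x.1) := by rw [hsq]; exact hx.isUnit
    rw [Matrix.isUnit_iff_isUnit_det, det_mul] at this
    rw [Matrix.isUnit_iff_isUnit_det]
    exact isUnit_of_mul_isUnit_left this
  · exact (cfc_predicate Real.sqrt x.1 : IsSelfAdjoint _)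

/-- Each flat is an isometric copy of Euclidean space. -/
theorem PDMat.dist_flat {n : ℕ} (g : GL (Fin n) ℂ) (α β : Fin n → ℝ) :
    dist (PDMat.flat g α) (PDMat.flat g β) = √(∑ i, (β i - α i) ^ 2) := by
  obtain ⟨hu, hh, hsq⟩ := PDMat.sqrt_facts (PDMat.flat g α)
  change frobNorm (cfc Real.log ((cfc Real.sqrt (PDMat.flat g α).1)⁻¹ * (PDMat.flat g β).1 *
    (cfc Real.sqrt (PDMat.flat g α).1)⁻¹)) = _
  set S := cfc Real.sqrt (PDMat.flat g α).1 with hS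
  have hdet : IsUnit S.det := (Matrix.isUnit_iff_isUnit_det S).1 hu
  have hi : (S⁻¹)ᴴ = S⁻¹ := by rw [conjTranspose_nonsing_inv, hh]
  set W := S⁻¹ * (g : Matrix (Fin n) (Fin n) ℂ) * expDiag ((1 / 2 : ℝ) • α) with hWdef
  have hWW : W * Wᴴ = 1 := by
    have e : expDiag ((1 / 2 : ℝ) • α) * expDiag ((1 / 2 : ℝ) • α) = expDiag α := by
      rw [expDiag_mul, ← add_smul]; norm_num
    calc W * Wᴴ = S⁻¹ * ((g : Matrix (Fin n) (Fin n) ℂ) *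
          (expDiag ((1 / 2 : ℝ) • α) * expDiag ((1 / 2 : ℝ) • α)) *
          (g : Matrix (Fin n) (Fin n) ℂ)ᴴ) * S⁻¹ := by
          simp only [hWdef, conjTranspose_mul, expDiag_conjTranspose, hi, Matrix.mul_assoc]
      _ = S⁻¹ * (S * S) * S⁻¹ := by rw [e, hsq]; rfl
      _ = 1 := by
        rw [← Matrix.mul_assoc, Matrix.nonsing_inv_mul _ hdet, Matrix.one_mul,
          Matrix.mul_nonsing_inv _ hdet]
  have hM : S⁻¹ * (PDMat.flat g β).1 * S⁻¹ = W * expDiag (β - α) * Wᴴ := by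
    have e : expDiag ((1 / 2 : ℝ) • α) * (expDiag (β - α) * expDiag ((1 / 2 : ℝ) • α)) =
        expDiag β := by
      rw [expDiag_mul, expDiag_mul]
      congr 1
      ext i
      simp only [Pi.add_apply, Pi.smul_apply, Pi.sub_apply, smul_eq_mul]
      ring
    calc S⁻¹ * (PDMat.flat g β).1 * S⁻¹ = S⁻¹ * ((g : Matrix (Fin n) (Fin n) ℂ) *
          (expDiag ((1 / 2 : ℝ) • α) * (expDiag (β - α) * expDiag ((1 / 2 : ℝ) • α))) *
          (g : Matrix (Fin n) (Fin n) ℂ)ᴴ) * S⁻¹ := by rw [e]; rfl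
      _ = W * expDiag (β - α) * Wᴴ := by
        simp only [hWdef, conjTranspose_mul, expDiag_conjTranspose, hi, Matrix.mul_assoc]
  rw [hM, cfc_unitary_conj _ _ _ hWW (posDef_expDiag _).isHermitian, cfc_log_expDiag,
    frobNorm_unitary_conj _ _ hWW]
  unfold frobNorm
  congr 1
  refine Finset.sum_congr rfl fun i _ => ?_
  rw [Finset.sum_eq_single i (fun j _ hj => by simp [diagonal_apply_ne' _ hj]) (by simp)]
  rw [diagonal_apply_eq, Complex.norm_real, Real.norm_eq_abs, sq_abs, Pi.sub_apply]

/-- The ray `t ↦ g e^{t diag α} g†`. -/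
def PDMat.ray {n : ℕ} (g : GL (Fin n) ℂ) (α : Fin n → ℝ) : Ray (PDMat n) where
  toFun t := PDMat.flat g ((t : ℝ) • α)
  exists_speed := by
    refine ⟨√(∑ i, α i ^ 2), Real.sqrt_nonneg _, fun s t => ?_⟩
    rw [PDMat.dist_flat, ← Real.sqrt_sq (abs_nonneg ((s : ℝ) - t)),
      ← Real.sqrt_mul (Finset.sum_nonneg fun i _ => sq_nonneg _), sq_abs, Finset.sum_mul]
    congr 1
    refine Finset.sum_congr rfl fun i _ => ?_
    simp only [Pi.smul_apply, smul_eq_mul]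
    ring

/-- The point `α · [g]` of `C P_n^∞` : the class of the ray `t ↦ g e^{t diag α} g†`. -/
def flagPoint {n : ℕ} (α : Fin n → ℝ) (g : GL (Fin n) ℂ) : BoundaryCone (PDMat n) :=
  BoundaryCone.mk (PDMat.ray g α)

theorem exists_adapted {n : ℕ} (X : Submodule ℂ (Fin n → ℂ)) :
    ∃ g : GL (Fin n) ℂ, Submodule.span ℂ
      {v | ∃ j : Fin n, (j : ℕ) < Module.finrank ℂ X ∧
        v = fun i => (g : Matrix (Fin n) (Fin n) ℂ) i j} = X := by
  obtain ⟨Z, hZ⟩ := X.exists_isCompl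
  set k := Module.finrank ℂ X with hk
  have hdim : k + Module.finrank ℂ Z = n := by
    have := Submodule.finrank_add_eq_of_isCompl hZ
    simpa using this
  let e : Fin k ⊕ Fin (Module.finrank ℂ Z) ≃ Fin n := finSumFinEquiv.trans (finCongr hdim)
  let b : Module.Basis (Fin n) ℂ (Fin n → ℂ) :=
    (((Module.finBasis ℂ X).prod (Module.finBasis ℂ Z)).map
      (Submodule.prodEquivOfIsCompl X Z hZ)).reindex e
  have hb : ∀ i : Fin k, b (e (Sum.inl i)) = (Module.finBasis ℂ X i : Fin n → ℂ) := by
    intro i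
    simp [b]
  have hunit : IsUnit ((Pi.basisFun ℂ (Fin n)).toMatrix b) :=
    (Module.Basis.isUnit_det _ b |> fun h => by
      rw [Matrix.isUnit_iff_isUnit_det]; simpa [Module.Basis.det_apply] using h)
  refine ⟨hunit.unit, ?_⟩
  have hset : {v | ∃ j : Fin n, (j : ℕ) < k ∧
      v = fun i => ((hunit.unit : GL (Fin n) ℂ) : Matrix (Fin n) (Fin n) ℂ) i j} =
      X.subtype '' Set.range (Module.finBasis ℂ X) := by
    ext v
    simp only [Set.mem_ofPred_eq, Set.mem_image, Set.exists_range_iff, Submodule.subtype_apply,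
      IsUnit.unit_spec, Module.Basis.toMatrix_apply, Pi.basisFun_repr]
    constructor
    · rintro ⟨j, hj, rfl⟩
      refine ⟨⟨j, hj⟩, ?_⟩
      rw [← hb]
      have : e (Sum.inl ⟨j, hj⟩) = j := by ext; simp [e]
      rw [this]
    · rintro ⟨i, rfl⟩
      refine ⟨e (Sum.inl i), by simp [e], ?_⟩
      rw [← hb]
  rw [hset, Submodule.span_image, Module.Basis.span_eq, Submodule.map_top, Submodule.range_subtype]

/-- A vector subspace `X` of `ℂⁿ` as a point of `C P_n^∞` : the point `(1, …, 1, 0, …, 0) · [g]`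
with `k = dim X` ones, where the first `k` columns of `g` span `X`. -/
def subspacePoint {n : ℕ} (X : Submodule ℂ (Fin n → ℂ)) : BoundaryCone (PDMat n) :=
  flagPoint (fun i => if (i : ℕ) < Module.finrank ℂ X then 1 else 0) (exists_adapted X).choose

theorem Ray.pair_asymptotic {n : ℕ} {c₁ c₂ c₁' c₂' : Ray (PDMat n)} (h : c₁.Asymptotic c₂)
    (h' : c₁'.Asymptotic c₂') : (Ray.pair c₁ c₁').Asymptotic (Ray.pair c₂ c₂') := by
  obtain ⟨K, hK⟩ := h
  obtain ⟨K', hK'⟩ := h'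
  refine ⟨√(K ^ 2 + K' ^ 2), fun t => ?_⟩
  change dist (WithLp.toLp 2 (_, _)) (WithLp.toLp 2 (_, _)) ≤ _
  rw [l2_dist]
  have h₁ := pow_le_pow_left₀ (PDMat.dist_nonneg _ _) (hK t) 2
  have h₂ := pow_le_pow_left₀ (PDMat.dist_nonneg _ _) (hK' t) 2
  exact Real.sqrt_le_sqrt (add_le_add h₁ h₂)

/-- The product `P_n × P_n`, with the `ℓ²`-product distance. -/
abbrev PDPair (n : ℕ) : Type := WithLp 2 (PDMat n × PDMat n)

/-- The point `(p, q)` of `C(P_n × P_n)^∞ = C P_n^∞ × C P_n^∞` : the class of the rays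
`t ↦ (c t, c' t)` with `c(∞) = p` and `c'(∞) = q`. -/
def pairPoint {n : ℕ} : BoundaryCone (PDMat n) → BoundaryCone (PDMat n) →
    BoundaryCone (PDPair n) :=
  Quot.map₂ Ray.pair
    (fun c _ _ h => Ray.pair_asymptotic ⟨0, fun t => (c.dist_self t).le⟩ h)
    (fun _ _ c h => Ray.pair_asymptotic h ⟨0, fun t => (c.dist_self t).le⟩)

/-! ### The function of operator scaling -/

/-- `f_A(x, y) = n log ∑ₖ tr (x Aₖ y Aₖ†)`. -/
def scalingFun {n m : ℕ} (A : Fin m → Matrix (Fin n) (Fin n) ℂ) (z : PDPair n) : ℝ :=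
  n * Real.log (∑ k, (trace (z.fst.1 * A k * z.snd.1 * (A k)ᴴ)).re)

/-- The family `S_A` of all pairs `(X, Y)` of subspaces with `u† Aₖ v = 0` for all
`u ∈ X`, `v ∈ Y` and all `k`. -/
def annihilatedPairs {n m : ℕ} (A : Fin m → Matrix (Fin n) (Fin n) ℂ) :
    Set (Submodule ℂ (Fin n → ℂ) × Submodule ℂ (Fin n → ℂ)) :=
  {S | ∀ u ∈ S.1, ∀ v ∈ S.2, ∀ k, star u ⬝ᵥ (A k *ᵥ v) = 0}

end

noncomputable section

/-! ### Asymptotic rays and angles -/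

/-! All computations take place in flats `g e^{diag α} g†`, which are isometric to Euclidean space.
The metric geometry needed around them comes from height functions `F = ∑ aᵢ log (i-th leading
minor)`, where `a` consists of the successive differences of `α`. Such an `F` is linear on the
standard flat. Along a geodesic with direction `β` its slope is `∑ αⱼ |W j l|² βₗ` for some unitary
`W`, hence at most `‖α‖ ‖β‖`. So `F` is `‖α‖`-Lipschitz, which yields the triangle inequality; the
case of equality yields uniqueness of geodesics, so every constant-speed ray lies in a flat
(`exists_lipschitz_height`, `exists_eq_ray`).

At infinity, `α · [g]` does not change when `g` is multiplied on the right by an element of the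
parabolic subgroup of `α` (`flagPoint_mul`). By the Bruhat decomposition two boundary points
therefore have a common frame (`exists_common_frame`). In a common frame the inner product is the
dot product of the coordinates, and it is additive on products (`inner_flagPoint`,
`inner_pairPoint`).

On a product of two flats, `f_A` is `n` times the logarithm of a sum of exponentials with
coefficients `|(g† Aₖ h) i j|²`. Along a ray it stays within bounded distance of `n` times the
largest exponent that occurs. Since `f_A` is Lipschitz, the limit is the same along all asymptotic
rays (`recession_scalingFun`).

For `B`, the points `±(1,…,1)` in either factor give the two equations, and pairs of subspaces give
the inequalities. Conversely, sort `α` and `β` decreasingly and let `M` be the maximum in the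
recession formula. For each real `s` the frame vectors with `αᵢ ≥ s` and those with `βⱼ > M - s`
span a pair in `S_A`, because `αᵢ + βⱼ > M` forces the entry to vanish. Integrating the inequalities
of these pairs over `s` gives the inequality at `(α, β)` (`sum_mul_add_sum_mul_le`). -/

/-- The distance satisfies the axioms of a pseudometric. -/
class IsPseudoDist (X : Type*) [Dist X] : Prop where
  dist_self : ∀ x : X, dist x x = 0
  dist_comm : ∀ x y : X, dist x y = dist y x
  dist_triangle : ∀ x y z : X, dist x z ≤ dist x y + dist y z

namespace IsPseudoDist

variable {X : Type*} [Dist X] [IsPseudoDist X]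

theorem dist_nonneg (x y : X) : 0 ≤ dist x y := by
  have h := dist_triangle x y x
  rw [dist_self, dist_comm y x] at h
  linarith

theorem abs_dist_sub_le (x y x' y' : X) : |dist x y - dist x' y'| ≤ dist x x' + dist y y' := by
  have h₁ := dist_triangle x x' y
  have h₂ := dist_triangle x' y' y
  have h₃ := dist_triangle x' x y'
  have h₄ := dist_triangle x y y'
  rw [dist_comm y' y] at h₂
  rw [dist_comm x' x] at h₃
  rw [abs_le]
  constructor <;> linarith

end IsPseudoDist

theorem Ray.speed_nonneg {X : Type*} [Dist X] (c : Ray X) : 0 ≤ dist (c 0) (c 1) := by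
  obtain ⟨r, hr, h⟩ := c.exists_speed
  rw [h]; positivity

theorem Ray.dist_eq {X : Type*} [Dist X] (c : Ray X) (s t : ℝ≥0) :
    dist (c s) (c t) = dist (c 0) (c 1) * |(s : ℝ) - t| := by
  obtain ⟨r, -, h⟩ := c.exists_speed
  rw [h, h]; simp

theorem Ray.dist_zero_left {X : Type*} [Dist X] (c : Ray X) (t : ℝ≥0) :
    dist (c 0) (c t) = dist (c 0) (c 1) * t := by
  rw [c.dist_eq]; simp

namespace Ray.Asymptotic

variable {X : Type*} [Dist X] [IsPseudoDist X]

theorem equivalence : Equivalence (Ray.Asymptotic (X := X)) where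
  refl c := ⟨0, fun t => (c.dist_self t).le⟩
  symm := fun ⟨K, hK⟩ => ⟨K, fun t => by rw [IsPseudoDist.dist_comm]; exact hK t⟩
  trans := fun ⟨K, hK⟩ ⟨K', hK'⟩ => ⟨K + K', fun t =>
    (IsPseudoDist.dist_triangle _ _ _).trans (add_le_add (hK t) (hK' t))⟩

/-- Different speeds would make the distances from the starting points differ by an amount linear in
`t`, while asymptoticity bounds the difference by `2 K`. -/
theorem speed_eq {c c' : Ray X} (h : c.Asymptotic c') :
    dist (c 0) (c 1) = dist (c' 0) (c' 1) := by
  obtain ⟨K, hK⟩ := h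
  by_contra hne
  have hpos : 0 < |dist (c 0) (c 1) - dist (c' 0) (c' 1)| := abs_pos.2 (sub_ne_zero.2 hne)
  obtain ⟨N, hN⟩ := exists_nat_gt (2 * K / |dist (c 0) (c 1) - dist (c' 0) (c' 1)|)
  rw [div_lt_iff₀ hpos] at hN
  have h1 := IsPseudoDist.abs_dist_sub_le (c 0) (c N) (c' 0) (c' N)
  rw [c.dist_zero_left, c'.dist_zero_left, ← sub_mul, abs_mul] at h1
  have h2 := hK 0
  have h3 := hK N
  have h4 : |((N : ℝ≥0) : ℝ)| = N := by simp
  rw [h4] at h1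
  linarith

end Ray.Asymptotic

namespace BoundaryCone

variable {X : Type*} [Dist X] [IsPseudoDist X]

theorem mk_eq_mk {c c' : Ray X} : mk c = mk c' ↔ c.Asymptotic c' :=
  Quot.eq.trans (Ray.Asymptotic.equivalence.eqvGen_iff)

theorem norm_mk (c : Ray X) : (mk c).norm = dist (c 0) (c 1) :=
  Ray.Asymptotic.speed_eq (mk_eq_mk.1 (Quot.out_eq (mk c)))

theorem tendsto_div_of_bounded {u : ℝ≥0 → ℝ} {K : ℝ} (hu : ∀ t, |u t| ≤ K) :
    Tendsto (fun t : ℝ≥0 => u t / (t : ℝ)) atTop (𝓝 0) := by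
  have h : Tendsto (fun t : ℝ≥0 => K / (t : ℝ)) atTop (𝓝 0) :=
    (NNReal.tendsto_coe_atTop.2 tendsto_id).const_div_atTop K
  refine squeeze_zero_norm (fun t => ?_) h
  rw [Real.norm_eq_abs, abs_div, abs_of_nonneg t.coe_nonneg]
  exact div_le_div_of_nonneg_right (hu t) t.2

/-- The triangle inequalities keep the argument of `arccos` in `[-1, 1]`, so no truncation occurs.
-/
theorem cos_comparisonAngle {x y z : X} (hy : 0 < dist x y) (hz : 0 < dist x z) :
    Real.cos (comparisonAngle x y z) =
      (dist x y ^ 2 + dist x z ^ 2 - dist y z ^ 2) / (2 * dist x y * dist x z) := by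
  have h₁ := IsPseudoDist.dist_triangle x y z
  have h₂ := IsPseudoDist.dist_triangle x z y
  have h₃ := IsPseudoDist.dist_triangle y x z
  have h₄ := IsPseudoDist.dist_nonneg y z
  rw [IsPseudoDist.dist_comm z y] at h₂
  rw [IsPseudoDist.dist_comm y x] at h₃
  apply Real.cos_arccos
  · rw [le_div_iff₀ (by positivity)]
    nlinarith
  · rw [div_le_iff₀ (by positivity)]
    nlinarith

/-- An angle of two classes is determined by the rate at which their rays diverge. -/
theorem IsAngle.tendsto {p q : BoundaryCone X} {θ : ℝ} (h : IsAngle p q θ) (hp : 0 < p.norm)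
    (hq : 0 < q.norm) {c c' : Ray X} (hc : mk c = p) (hc' : mk c' = q) :
    Tendsto (fun t : ℝ≥0 => dist (c t) (c' t) / t) atTop
      (𝓝 √(p.norm ^ 2 + q.norm ^ 2 - 2 * p.norm * q.norm * Real.cos θ)) := by
  obtain ⟨b, b', rfl, rfl, hb0, hlim⟩ := h
  rw [norm_mk] at hp hq
  rw [norm_mk, norm_mk]
  set r := dist (b 0) (b 1) with hr
  set r' := dist (b' 0) (b' 1) with hr'
  have h1 : Tendsto (fun t : ℝ≥0 => Real.cos (comparisonAngle (b 0) (b t) (b' t))) atTop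
      (𝓝 (Real.cos θ)) := by
    have hdiag : Tendsto (fun t : ℝ≥0 => (t, t)) atTop (atTop ×ˢ atTop) :=
      tendsto_id.prodMk tendsto_id
    have := hlim.comp hdiag
    exact (Real.continuous_cos.tendsto θ).comp this
  have h2 : Tendsto (fun t : ℝ≥0 => dist (b t) (b' t) / (t : ℝ)) atTop
      (𝓝 √(r ^ 2 + r' ^ 2 - 2 * r * r' * Real.cos θ)) := by
    have h3 := (Real.continuous_sqrt.tendsto _).comp
      ((h1.const_mul (2 * r * r')).const_sub (r ^ 2 + r' ^ 2))
    refine h3.congr' ?_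
    filter_upwards [eventually_gt_atTop 0] with t ht
    have ht' : (0 : ℝ) < t := ht
    have e1 : dist (b 0) (b t) = r * t := b.dist_zero_left t
    have e2 : dist (b 0) (b' t) = r' * t := by rw [hb0]; exact b'.dist_zero_left t
    have e3 := IsPseudoDist.dist_nonneg (b t) (b' t)
    simp only [Function.comp_apply]
    rw [cos_comparisonAngle (by rw [e1]; positivity) (by rw [e2]; positivity), e1, e2]
    rw [show r ^ 2 + r' ^ 2 - 2 * r * r' * (((r * t) ^ 2 + (r' * t) ^ 2 - dist (b t) (b' t) ^ 2) /
      (2 * (r * t) * (r' * t))) = (dist (b t) (b' t) / t) ^ 2 by field_simp; ring]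
    exact Real.sqrt_sq (by positivity)
  -- Replacing the rays by asymptotic ones changes the distance by a bounded amount, which
  -- disappears after division by `t`.
  obtain ⟨K, hK⟩ := mk_eq_mk.1 hc
  obtain ⟨K', hK'⟩ := mk_eq_mk.1 hc'
  have h4 := tendsto_div_of_bounded (u := fun t => dist (c t) (c' t) - dist (b t) (b' t))
    (fun t => (IsPseudoDist.abs_dist_sub_le _ _ _ _).trans (add_le_add (hK t) (hK' t)))
  simpa [← add_div] using h2.add h4

/-- The inner product of two classes represented by rays in a common Euclidean sector. -/
theorem inner_mk {c c' : Ray X} {a b I : ℝ} (h0 : c 0 = c' 0)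
    (h : ∀ s t : ℝ≥0, dist (c s) (c' t) ^ 2 = a * s ^ 2 + b * t ^ 2 - 2 * I * s * t) :
    inner (mk c) (mk c') = I := by
  have ha : a = dist (c 0) (c 1) ^ 2 := by
    have := h 1 0
    rw [← h0, IsPseudoDist.dist_comm] at this
    simpa using this.symm
  have hb : b = dist (c' 0) (c' 1) ^ 2 := by
    have := h 0 1
    rw [h0] at this
    simpa using this.symm
  unfold inner
  rw [norm_mk, norm_mk]
  set r := dist (c 0) (c 1) with hr
  set r' := dist (c' 0) (c' 1) with hr'
  have hr0 : 0 ≤ r := c.speed_nonneg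
  have hr0' : 0 ≤ r' := c'.speed_nonneg
  -- The Cauchy–Schwarz bound, read off from the triangle inequalities at times `s = t = 1`.
  have hI : |I| ≤ r * r' := by
    have e := h 1 1
    have t₁ := IsPseudoDist.dist_triangle (c 1) (c 0) (c' 1)
    have t₂ := IsPseudoDist.dist_triangle (c 0) (c 1) (c' 1)
    have t₃ := IsPseudoDist.dist_triangle (c' 0) (c' 1) (c 1)
    have t₄ := IsPseudoDist.dist_nonneg (c 1) (c' 1)
    rw [IsPseudoDist.dist_comm (c 1) (c 0), h0, ← hr', ← h0, ← hr] at t₁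
    rw [← hr, h0, ← hr'] at t₂
    rw [← hr', ← h0, ← hr, IsPseudoDist.dist_comm (c' 1)] at t₃
    rw [ha, hb] at e
    simp only [NNReal.coe_one, one_pow, mul_one] at e
    rw [abs_le]
    constructor <;> nlinarith
  -- At speed zero the angle is arbitrary, but the factor `r` kills it, and `I = 0` by the bound
  -- just proved.
  rcases hr0.eq_or_lt with hz | hpos
  · rw [← hz] at hI ⊢
    simp only [zero_mul] at hI ⊢
    exact (abs_nonpos_iff.1 hI).symm
  rcases hr0'.eq_or_lt with hz | hpos'
  · rw [← hz] at hI ⊢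
    simp only [mul_zero, zero_mul] at hI ⊢
    exact (abs_nonpos_iff.1 hI).symm
  have hangle : IsAngle (mk c) (mk c') (Real.arccos (I / (r * r'))) := by
    refine ⟨c, c', rfl, rfl, h0, tendsto_const_nhds.congr' ?_⟩
    filter_upwards [(eventually_gt_atTop 0).prod_mk (eventually_gt_atTop 0)] with s hs
    have hs1 : (0 : ℝ) < s.1 := hs.1
    have hs2 : (0 : ℝ) < s.2 := hs.2
    unfold comparisonAngle
    have e1 : dist (c 0) (c s.1) = r * s.1 := c.dist_zero_left _
    have e2 : dist (c 0) (c' s.2) = r' * s.2 := by rw [h0]; exact c'.dist_zero_left _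
    rw [e1, e2, h, ha, hb]
    congr 1
    field_simp
    ring
  -- `angle` is some choice among all admissible `θ`. Each of them prescribes the same rate of
  -- divergence of `c` and `c'`, and so the same cosine.
  have key : ∀ θ, IsAngle (mk c) (mk c') θ → r * r' * Real.cos θ = I := by
    intro θ hθ
    have l₁ := hθ.tendsto (by rwa [norm_mk]) (by rwa [norm_mk]) rfl rfl
    have l₂ : Tendsto (fun t : ℝ≥0 => dist (c t) (c' t) / t) atTop (𝓝 √(a + b - 2 * I)) := by
      refine tendsto_const_nhds.congr' ?_
      filter_upwards [eventually_gt_atTop 0] with t ht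
      have ht' : (0 : ℝ) < t := ht
      have e3 := IsPseudoDist.dist_nonneg (c t) (c' t)
      rw [show a + b - 2 * I = (dist (c t) (c' t) / t) ^ 2 by rw [div_pow, h]; field_simp]
      exact Real.sqrt_sq (by positivity)
    have e := tendsto_nhds_unique l₁ l₂
    rw [norm_mk, norm_mk, ← hr, ← hr', Real.sqrt_inj, ha, hb] at e
    · linarith
    · nlinarith [Real.cos_le_one θ, mul_pos hpos hpos', sq_nonneg (r - r')]
    · rw [ha, hb]
      nlinarith [(abs_le.1 hI).2, sq_nonneg (r - r')]
  exact key _ (Classical.epsilon_spec ⟨_, hangle⟩)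

end BoundaryCone

/-! ### Products -/

instance IsPseudoDist.prod {X Y : Type*} [Dist X] [Dist Y] [IsPseudoDist X] [IsPseudoDist Y] :
    IsPseudoDist (WithLp 2 (X × Y)) where
  dist_self := by
    rintro ⟨x, y⟩
    rw [l2_dist, IsPseudoDist.dist_self, IsPseudoDist.dist_self]
    simp
  dist_comm := by
    rintro ⟨x, y⟩ ⟨x', y'⟩
    rw [l2_dist, l2_dist, IsPseudoDist.dist_comm x, IsPseudoDist.dist_comm y]
  dist_triangle := by
    rintro ⟨x, y⟩ ⟨x', y'⟩ ⟨x'', y''⟩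
    rw [l2_dist, l2_dist, l2_dist]
    have h := IsPseudoDist.dist_triangle x x' x''
    have h' := IsPseudoDist.dist_triangle y y' y''
    have n₁ := IsPseudoDist.dist_nonneg x x'
    have n₂ := IsPseudoDist.dist_nonneg x' x''
    have n₃ := IsPseudoDist.dist_nonneg x x''
    have n₁' := IsPseudoDist.dist_nonneg y y'
    have n₂' := IsPseudoDist.dist_nonneg y' y''
    have n₃' := IsPseudoDist.dist_nonneg y y''
    calc _ ≤ √((dist x x' + dist x' x'') ^ 2 + (dist y y' + dist y' y'') ^ 2) := by gcongr
      _ ≤ _ := by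
        have := norm_add_le (!₂[dist x x', dist y y'] : EuclideanSpace ℝ (Fin 2))
          !₂[dist x' x'', dist y' y'']
        simpa [EuclideanSpace.norm_eq] using this

theorem dist_le_l2_dist {X Y : Type*} [Dist X] [Dist Y] (a b : X) (a' b' : Y) :
    dist a b ≤ dist (WithLp.toLp 2 (a, a')) (WithLp.toLp 2 (b, b')) ∧
      dist a' b' ≤ dist (WithLp.toLp 2 (a, a')) (WithLp.toLp 2 (b, b')) := by
  rw [l2_dist]
  constructor <;> apply Real.le_sqrt_of_sq_le <;>
    nlinarith [sq_nonneg (dist a b), sq_nonneg (dist a' b')]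

section Product

variable {X Y : Type*} [Dist X] [Dist Y] [IsPseudoDist X] [IsPseudoDist Y]

theorem Ray.pair_asymptotic_iff {c₁ c₂ : Ray X} {c₁' c₂' : Ray Y} :
    (Ray.pair c₁ c₁').Asymptotic (Ray.pair c₂ c₂') ↔ c₁.Asymptotic c₂ ∧ c₁'.Asymptotic c₂' := by
  constructor
  · rintro ⟨K, hK⟩
    exact ⟨⟨K, fun t => (dist_le_l2_dist _ _ _ _).1.trans (hK t)⟩,
      ⟨K, fun t => (dist_le_l2_dist _ _ _ _).2.trans (hK t)⟩⟩
  · rintro ⟨⟨K, hK⟩, K', hK'⟩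
    refine ⟨√(K ^ 2 + K' ^ 2), fun t => ?_⟩
    change dist (WithLp.toLp 2 (_, _)) (WithLp.toLp 2 (_, _)) ≤ _
    rw [l2_dist]
    have h₁ := pow_le_pow_left₀ (IsPseudoDist.dist_nonneg _ _) (hK t) 2
    have h₂ := pow_le_pow_left₀ (IsPseudoDist.dist_nonneg _ _) (hK' t) 2
    exact Real.sqrt_le_sqrt (add_le_add h₁ h₂)

end Product

/-- Equality in the componentwise Minkowski inequality forces proportional vectors. -/
theorem eq_smul_of_le_add {a₁ b₁ a₂ b₂ a b r l₁ l₂ : ℝ} (hl₁ : 0 ≤ l₁) (hl₂ : 0 ≤ l₂)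
    (hl : 0 < l₁ + l₂)
    (ha : 0 ≤ a) (hb : 0 ≤ b) (ha' : a ≤ a₁ + a₂) (hb' : b ≤ b₁ + b₂)
    (h₁ : a₁ ^ 2 + b₁ ^ 2 = (r * l₁) ^ 2) (h₂ : a₂ ^ 2 + b₂ ^ 2 = (r * l₂) ^ 2)
    (h : a ^ 2 + b ^ 2 = (r * (l₁ + l₂)) ^ 2) :
    (a₁ = a * (l₁ / (l₁ + l₂)) ∧ a₂ = a * (l₂ / (l₁ + l₂))) ∧
      b₁ = b * (l₁ / (l₁ + l₂)) ∧ b₂ = b * (l₂ / (l₁ + l₂)) := by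
  have hA := pow_le_pow_left₀ ha ha' 2
  have hB := pow_le_pow_left₀ hb hb' 2
  -- The vectors `(a₁, b₁)` and `(a₂, b₂)` have lengths `|r| l₁` and `|r| l₂`, and their sum is at
  -- least as long as the two lengths together; this is equality in Cauchy–Schwarz.
  have hz : (l₁ * a₂ - l₂ * a₁) ^ 2 + (l₁ * b₂ - l₂ * b₁) ^ 2 ≤ 0 := by
    have : r ^ 2 * (l₁ * l₂) ≤ a₁ * a₂ + b₁ * b₂ := by nlinarith
    have e : (l₁ * a₂ - l₂ * a₁) ^ 2 + (l₁ * b₂ - l₂ * b₁) ^ 2 =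
        l₁ ^ 2 * (a₂ ^ 2 + b₂ ^ 2) + l₂ ^ 2 * (a₁ ^ 2 + b₁ ^ 2) -
          2 * (l₁ * l₂ * (a₁ * a₂ + b₁ * b₂)) := by ring
    rw [e, h₁, h₂]
    nlinarith [mul_le_mul_of_nonneg_left this (mul_nonneg hl₁ hl₂)]
  have z₁ : l₁ * a₂ - l₂ * a₁ = 0 := by
    nlinarith [sq_nonneg (l₁ * a₂ - l₂ * a₁), sq_nonneg (l₁ * b₂ - l₂ * b₁)]
  have z₂ : l₁ * b₂ - l₂ * b₁ = 0 := by
    nlinarith [sq_nonneg (l₁ * a₂ - l₂ * a₁), sq_nonneg (l₁ * b₂ - l₂ * b₁)]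
  have s : (a₁ + a₂) ^ 2 + (b₁ + b₂) ^ 2 ≤ (r * (l₁ + l₂)) ^ 2 := by
    have : (a₁ * a₂ + b₁ * b₂) * (l₁ + l₂) ≤ r ^ 2 * (l₁ * l₂) * (l₁ + l₂) := by
      have e₁ : a₂ * l₁ = a₁ * l₂ := by linarith
      have e₂ : b₂ * l₁ = b₁ * l₂ := by linarith
      have : (a₁ * a₂ + b₁ * b₂) * (l₁ + l₂) =
        (a₁ ^ 2 + b₁ ^ 2) * l₂ + (a₂ ^ 2 + b₂ ^ 2) * l₁ := by linear_combination a₁ * e₁ + b₁ * e₂ - a₂ * e₁ - b₂ * e₂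
      rw [this, h₁, h₂]
      apply le_of_eq
      ring
    nlinarith [le_of_mul_le_mul_right this hl]
  have w₁ : a = a₁ + a₂ := by
    by_contra hne
    have hlt := lt_of_le_of_ne ha' hne
    nlinarith
  have w₂ : b = b₁ + b₂ := by
    by_contra hne
    have hlt := lt_of_le_of_ne hb' hne
    nlinarith
  subst w₁ w₂
  refine ⟨⟨?_, ?_⟩, ?_, ?_⟩ <;> field_simp <;> linarith

/-- Comparing `[0, t]` and `[0, 1]` inside `[0, max 1 t]` identifies the speed as `dist (b 0) (b
1)`; then `[s, t]` is compared with `[0, t]`. -/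
theorem exists_speed_of_affine {Z : Type*} [Dist Z] [IsPseudoDist Z] (b : ℝ≥0 → Z)
    (hb : ∀ s t w : ℝ≥0, s ≤ t → t ≤ w → s < w →
      dist (b s) (b t) = dist (b s) (b w) * (((t : ℝ) - s) / (w - s)) ∧
      dist (b t) (b w) = dist (b s) (b w) * (((w : ℝ) - t) / (w - s))) :
    ∃ r, 0 ≤ r ∧ ∀ s t : ℝ≥0, dist (b s) (b t) = r * |(s : ℝ) - t| := by
  have h0 : ∀ t : ℝ≥0, dist (b 0) (b t) = dist (b 0) (b 1) * t := by
    intro t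
    have hw : (0 : ℝ≥0) < max 1 t := lt_of_lt_of_le zero_lt_one (le_max_left _ _)
    have hw' : (0 : ℝ) < (max 1 t : ℝ≥0) := hw
    rw [(hb 0 t _ zero_le (le_max_right 1 t) hw).1, (hb 0 1 _ zero_le (le_max_left 1 t) hw).1]
    simp only [NNReal.coe_zero, sub_zero, NNReal.coe_one]
    field_simp
  have hlt : ∀ s t : ℝ≥0, s < t → dist (b s) (b t) = dist (b 0) (b 1) * (t - s) := by
    intro s t hst
    have ht : 0 < t := zero_le.trans_lt hst
    have ht' : (0 : ℝ) < t := ht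
    rw [(hb 0 s t zero_le hst.le ht).2, h0 t]
    simp only [NNReal.coe_zero, sub_zero]
    field_simp
  refine ⟨dist (b 0) (b 1), IsPseudoDist.dist_nonneg _ _, fun s t => ?_⟩
  rcases lt_trichotomy s t with hst | rfl | hst
  · rw [hlt s t hst, abs_sub_comm, abs_of_nonneg (sub_nonneg.2 (NNReal.coe_le_coe.2 hst.le))]
  · simp [IsPseudoDist.dist_self]
  · rw [IsPseudoDist.dist_comm, hlt t s hst, abs_of_nonneg (sub_nonneg.2 (NNReal.coe_le_coe.2 hst.le))]

/-- A constant-speed ray in the product is a pair of constant-speed rays. -/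
theorem Ray.exists_eq_pair {X Y : Type*} [Dist X] [Dist Y] [IsPseudoDist X] [IsPseudoDist Y]
    (c : Ray (WithLp 2 (X × Y))) : ∃ c₁ c₂, c = Ray.pair c₁ c₂ := by
  obtain ⟨r, hr, h⟩ := c.exists_speed
  have hd : ∀ s t, dist (c s).fst (c t).fst ^ 2 + dist (c s).snd (c t).snd ^ 2 =
      (r * |(s : ℝ) - t|) ^ 2 := by
    intro s t
    have e : dist (c s) (c t) = _ := l2_dist (c s).fst (c t).fst (c s).snd (c t).snd
    have e' : dist (c s) (c t) = r * |(s : ℝ) - t| := h s t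
    rw [← e', e, Real.sq_sqrt (by positivity)]
  have hprop : ∀ s t w : ℝ≥0, s ≤ t → t ≤ w → s < w →
      (dist (c s).fst (c t).fst = dist (c s).fst (c w).fst * (((t : ℝ) - s) / (w - s)) ∧
      dist (c t).fst (c w).fst = dist (c s).fst (c w).fst * (((w : ℝ) - t) / (w - s))) ∧
      dist (c s).snd (c t).snd = dist (c s).snd (c w).snd * (((t : ℝ) - s) / (w - s)) ∧
      dist (c t).snd (c w).snd = dist (c s).snd (c w).snd * (((w : ℝ) - t) / (w - s)) := by
    intro s t w hst htw hsw
    have hst' : (s : ℝ) ≤ t := hst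
    have htw' : (t : ℝ) ≤ w := htw
    have hsw' : (s : ℝ) < w := hsw
    have d₁ := hd s t
    have d₂ := hd t w
    have d₃ := hd s w
    rw [abs_sub_comm, abs_of_nonneg (by linarith)] at d₁ d₂ d₃
    have := eq_smul_of_le_add (l₁ := (t : ℝ) - s) (l₂ := w - t) (by linarith) (by linarith)
      (by linarith) (IsPseudoDist.dist_nonneg (c s).fst (c w).fst)
      (IsPseudoDist.dist_nonneg (c s).snd (c w).snd)
      (IsPseudoDist.dist_triangle _ _ _) (IsPseudoDist.dist_triangle _ _ _) d₁ d₂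
      (by rw [d₃]; ring)
    simpa using this
  obtain ⟨r₁, hr₁, h₁⟩ := exists_speed_of_affine (fun t => (c t).fst) fun s t w a b d => (hprop s t w a b d).1
  obtain ⟨r₂, hr₂, h₂⟩ := exists_speed_of_affine (fun t => (c t).snd) fun s t w a b d => (hprop s t w a b d).2
  exact ⟨⟨_, r₁, hr₁, h₁⟩, ⟨_, r₂, hr₂, h₂⟩, rfl⟩

/-! ### Leading minors along a flat -/

/-- A permutation other than the identity moves at least two indices, so after one factor is
differentiated an off-diagonal entry of the identity matrix still remains. Only the identity
permutation contributes. -/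
theorem hasDerivAt_det_of_eq_one {ι : Type*} [Fintype ι] [DecidableEq ι]
    {B : ℝ → Matrix ι ι ℂ} {B' : Matrix ι ι ℂ} {t : ℝ}
    (hB : ∀ i j, HasDerivAt (fun s => B s i j) (B' i j) t) (h1 : B t = 1) :
    HasDerivAt (fun s => (B s).det) B'.trace t := by
  simp only [det_apply]
  have h : HasDerivAt (fun s => ∑ σ : Equiv.Perm ι, Equiv.Perm.sign σ • ∏ i, B s (σ i) i)
      (∑ σ : Equiv.Perm ι, Equiv.Perm.sign σ •
        ∑ i, (∏ j ∈ Finset.univ.erase i, B t (σ j) j) • B' (σ i) i) t :=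
    HasDerivAt.fun_sum fun σ _ =>
      (HasDerivAt.fun_finsetProd fun i _ => hB (σ i) i).const_smul _
  convert h using 1
  rw [Finset.sum_eq_single 1]
  · simp [h1, trace]
  · intro σ _ hσ
    rw [Finset.sum_eq_zero, smul_zero]
    intro i _
    obtain ⟨j, hj, hji⟩ : ∃ j, σ j ≠ j ∧ j ≠ i := by
      by_contra! hcon
      apply hσ
      have hfix : ∀ j, j ≠ i → σ j = j := fun j hj => by
        by_contra h'
        exact hj (hcon j h')
      ext j
      by_cases hj : j = i
      · subst hj
        by_contra h'
        have := hfix (σ j) h'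
        exact h' (σ.injective this)
      · exact hfix j hj
    rw [Finset.prod_eq_zero (i := j) (by simp [hji]), zero_smul]
    rw [h1, one_apply_ne hj]
  · simp

/-- The block of a lower triangular `T` to the right of its leading block is zero, so no other
indices enter the product. -/
theorem toSquareBlockProp_conj {n : ℕ} {T : Matrix (Fin n) (Fin n) ℂ}
    (hT : ∀ i j, i < j → T i j = 0) (M : Matrix (Fin n) (Fin n) ℂ) (i : Fin n) :
    (T * M * Tᴴ).toSquareBlockProp (· ≤ i) =
      T.toSquareBlockProp (· ≤ i) * M.toSquareBlockProp (· ≤ i) *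
        (T.toSquareBlockProp (· ≤ i))ᴴ := by
  have hz : T.toBlock (· ≤ i) (fun j => ¬ j ≤ i) = 0 := by
    ext a b
    exact hT _ _ (lt_of_le_of_lt a.2 (not_le.1 b.2))
  have hz' : Tᴴ.toBlock (fun j => ¬ j ≤ i) (· ≤ i) = 0 := by
    ext a b
    have := congrFun (congrFun hz b) a
    simp only [toBlock_apply, Matrix.zero_apply] at this
    simp [this]
  unfold toSquareBlockProp
  rw [toBlock_mul_eq_add (fun j => j ≤ i) (fun j => j ≤ i) (fun j => j ≤ i),
    toBlock_mul_eq_add (fun j => j ≤ i) (fun j => j ≤ i) (fun j => j ≤ i), hz, hz']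
  simp only [Matrix.mul_zero, Matrix.zero_mul, add_zero]
  rfl

/-- The logarithm of the leading principal minor with last index `i`. -/
def logMinor {n : ℕ} (i : Fin n) (x : PDMat n) : ℝ :=
  Real.log (x.1.toSquareBlockProp (· ≤ i)).det.re

theorem leadingMinor_re_pos {n : ℕ} {M : Matrix (Fin n) (Fin n) ℂ} (hM : M.PosDef) (i : Fin n) :
    0 < (M.toSquareBlockProp (· ≤ i)).det.re := by
  have h : (M.toSquareBlockProp (· ≤ i)).PosDef :=
    hM.submatrix (e := fun j : {j : Fin n // j ≤ i} => (j : Fin n)) Subtype.val_injective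
  exact (Complex.pos_iff.1 h.det_pos).1

/-- Congruence by a lower triangular `T` shifts each logarithmic minor by a constant. With `T`
chosen to carry the point at time `t` to the identity, the geodesic becomes `W e^{(s - t) β} W†`,
and the derivative of a minor at the identity is a trace. -/
theorem hasDerivAt_logMinor {n : ℕ} {T : Matrix (Fin n) (Fin n) ℂ}
    (hT : ∀ i j, i < j → T i j = 0) (g : GL (Fin n) ℂ) (β : Fin n → ℝ) (t : ℝ)
    {W : Matrix (Fin n) (Fin n) ℂ}
    (hW : W = T * (g : Matrix (Fin n) (Fin n) ℂ) * expDiag ((t / 2) • β)) (hWW : W * Wᴴ = 1)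
    (i : Fin n) :
    HasDerivAt (fun s : ℝ => logMinor i (PDMat.flat g (s • β)))
      (∑ j with j ≤ i, ∑ l, ‖W j l‖ ^ 2 * β l) t := by
  have hflat : ∀ s : ℝ, T * (PDMat.flat g (s • β)).1 * Tᴴ = W * expDiag ((s - t) • β) * Wᴴ := by
    intro s
    have e : expDiag ((t / 2) • β) * (expDiag ((s - t) • β) * expDiag ((t / 2) • β)) =
        expDiag (s • β) := by
      rw [expDiag_mul, expDiag_mul, ← add_smul, ← add_smul]
      congr 2; ring
    calc T * (PDMat.flat g (s • β)).1 * Tᴴ = T * ((g : Matrix (Fin n) (Fin n) ℂ) *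
          (expDiag ((t / 2) • β) * (expDiag ((s - t) • β) * expDiag ((t / 2) • β))) *
          (g : Matrix (Fin n) (Fin n) ℂ)ᴴ) * Tᴴ := by rw [e]; rfl
      _ = W * expDiag ((s - t) • β) * Wᴴ := by
        simp only [hW, conjTranspose_mul, expDiag_conjTranspose, Matrix.mul_assoc]
  set B : ℝ → Matrix {j : Fin n // j ≤ i} {j : Fin n // j ≤ i} ℂ :=
    fun s => (W * expDiag ((s - t) • β) * Wᴴ).toSquareBlockProp (· ≤ i) with hB
  have hBe : ∀ s a b, B s a b =
      ∑ l, W a l * ((Real.exp ((s - t) * β l) : ℝ) : ℂ) * star (W b l) := by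
    intro s a b
    simp [hB, toSquareBlockProp, mul_apply, expDiag, diagonal_apply]
  have hBd : ∀ a b, HasDerivAt (fun s => B s a b)
      ((of fun a b : {j : Fin n // j ≤ i} => ∑ l, W a l * (β l : ℂ) * star (W b l)) a b) t := by
    intro a b
    simp only [hBe]
    change HasDerivAt _ (∑ l, W a l * (β l : ℂ) * star (W b l)) t
    refine HasDerivAt.fun_sum fun l _ => ?_
    refine HasDerivAt.mul_const (HasDerivAt.const_mul _ ?_) _
    have h1 : HasDerivAt (fun s : ℝ => Real.exp ((s - t) * β l)) (β l) t := by
      have := (((hasDerivAt_id t).sub_const t).mul_const (β l)).exp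
      simpa using this
    exact h1.ofReal_comp
  have hB1 : B t = 1 := by
    simp only [hB, sub_self, zero_smul, expDiag_zero, Matrix.mul_one, hWW]
    ext a b
    simp [toSquareBlockProp, one_apply, Subtype.ext_iff]
  have hdet := hasDerivAt_det_of_eq_one hBd hB1
  have hre : HasDerivAt (fun s => (B s).det.re) (∑ j with j ≤ i, ∑ l, ‖W j l‖ ^ 2 * β l) t := by
    have h := Complex.reCLM.hasFDerivAt.comp_hasDerivAt t hdet
    refine HasDerivAt.congr_deriv (f := fun s => (B s).det.re) h ?_
    simp only [trace, diag_apply, of_apply, Complex.reCLM_apply, Complex.re_sum]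
    rw [← Finset.sum_subtype_eq_sum_filter, Finset.subtype_univ]
    refine Finset.sum_congr rfl fun j _ => Finset.sum_congr rfl fun l _ => ?_
    rw [mul_right_comm, Complex.star_def, Complex.mul_conj, Complex.normSq_eq_norm_sq]
    norm_cast
  have hlog := hre.log (by rw [hB1]; simp)
  rw [hB1] at hlog
  simp only [det_one, Complex.one_re, div_one] at hlog
  have hval : ∀ s, logMinor i (PDMat.flat g (s • β)) = Real.log (B s).det.re -
      Real.log (Complex.normSq (T.toSquareBlockProp (· ≤ i)).det) := by
    intro s
    have hpos := leadingMinor_re_pos (PDMat.flat g (s • β)).2 i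
    have hc : (B s).det.re = Complex.normSq (T.toSquareBlockProp (· ≤ i)).det *
        ((PDMat.flat g (s • β)).1.toSquareBlockProp (· ≤ i)).det.re := by
      rw [hB]
      simp only
      rw [← hflat, toSquareBlockProp_conj hT, det_mul, det_mul, det_conjTranspose,
        mul_right_comm, Complex.star_def, Complex.mul_conj, Complex.re_ofReal_mul]
    -- Otherwise the leading minor of the positive definite matrix `W e^{(s - t) β} W†` would
    -- vanish.
    have hne : Complex.normSq (T.toSquareBlockProp (· ≤ i)).det ≠ 0 := by
      intro h0
      have hWu : (W * expDiag ((s - t) • β) * Wᴴ).PosDef := by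
        have hWu : IsUnit W := by
          rw [isUnit_iff_isUnit_det]
          have := congrArg det hWW
          rw [det_mul, det_one] at this
          exact IsUnit.of_mul_eq_one _ this
        have h := (Matrix.IsUnit.posDef_star_right_conjugate_iff (x := expDiag ((s - t) • β)) hWu).2
          (posDef_expDiag _)
        simpa [star_eq_conjTranspose] using h
      have := leadingMinor_re_pos hWu i
      change 0 < (B s).det.re at this
      rw [hc, h0, zero_mul] at this
      exact lt_irrefl _ this
    rw [hc, Real.log_mul hne hpos.ne', logMinor]
    ring
  simp only [hval]
  exact hlog.sub_const _

theorem logMinor_flat_one {n : ℕ} (i : Fin n) (β : Fin n → ℝ) :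
    logMinor i (PDMat.flat 1 β) = ∑ j with j ≤ i, β j := by
  have h : (PDMat.flat 1 β).1.toSquareBlockProp (· ≤ i) =
      diagonal fun j : {j : Fin n // j ≤ i} => ((Real.exp (β j) : ℝ) : ℂ) := by
    ext a b
    simp [PDMat.flat, toSquareBlockProp, expDiag, diagonal_apply, Subtype.ext_iff]
  rw [logMinor, h, det_diagonal, ← Complex.ofReal_prod, Complex.ofReal_re, ← Real.exp_sum,
    Real.log_exp, ← Finset.sum_subtype_eq_sum_filter, Finset.subtype_univ]

/-- Cholesky decomposition: the lower triangular factor of LDL, with its rows rescaled by the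
inverse square roots of the diagonal entries. -/
theorem exists_lower_conj_eq_one {n : ℕ} {M : Matrix (Fin n) (Fin n) ℂ} (hM : M.PosDef) :
    ∃ T : Matrix (Fin n) (Fin n) ℂ, (∀ i j, i < j → T i j = 0) ∧ T * M * Tᴴ = 1 := by
  have hD := LDL.diag_eq_lowerInv_conj hM
  have hpd : (LDL.diag hM).PosDef := by
    have h := (Matrix.IsUnit.posDef_star_right_conjugate_iff (x := M)
      (isUnit_of_invertible (LDL.lowerInv hM))).2 hM
    rw [hD]
    simpa [star_eq_conjTranspose] using h
  have hpos : ∀ i, 0 < LDL.diagEntries hM i := by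
    rw [LDL.diag, posDef_diagonal_iff] at hpd
    exact hpd
  set d : Fin n → ℝ := fun i => (LDL.diagEntries hM i).re with hd
  have hd0 : ∀ i, 0 < d i := fun i => (Complex.pos_iff.1 (hpos i)).1
  have hde : ∀ i, LDL.diagEntries hM i = (d i : ℂ) := fun i =>
    Complex.ext rfl (by simpa using (Complex.pos_iff.1 (hpos i)).2.symm)
  set E : Matrix (Fin n) (Fin n) ℂ := diagonal fun i => (((√(d i))⁻¹ : ℝ) : ℂ) with hE
  have hEE : Eᴴ = E := by
    rw [hE, diagonal_conjTranspose]
    congr 1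
    ext i
    simp
  refine ⟨E * LDL.lowerInv hM, fun i j hij => ?_, ?_⟩
  · rw [hE, diagonal_mul, LDL.lowerInv_triangular hM hij, mul_zero]
  · calc E * LDL.lowerInv hM * M * (E * LDL.lowerInv hM)ᴴ
        = E * (LDL.lowerInv hM * M * (LDL.lowerInv hM)ᴴ) * E := by
          simp only [conjTranspose_mul, hEE, Matrix.mul_assoc]
      _ = 1 := by
        rw [← hD, LDL.diag, hE, diagonal_mul_diagonal, diagonal_mul_diagonal, ← diagonal_one]
        congr 1
        ext i
        rw [hde, ← Complex.ofReal_mul, ← Complex.ofReal_mul, ← Complex.ofReal_one]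
        congr 1
        have := Real.mul_self_sqrt (hd0 i).le
        have h0 := (Real.sqrt_pos.2 (hd0 i)).ne'
        field_simp
        linarith

/-- The solution is `aᵢ = αᵢ - αᵢ₊₁`, with last entry `αₙ`. It converts a combination of logarithmic
minors into one with weights `α` by Abel summation. -/
theorem exists_sum_le_eq {n : ℕ} (α : Fin n → ℝ) :
    ∃ a : Fin n → ℝ, ∀ j, ∑ i with j ≤ i, a i = α j := by
  induction n with
  | zero => exact ⟨0, fun j => j.elim0⟩
  | succ n ih =>
    obtain ⟨a, ha⟩ := ih (fun j => α j.succ)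
    refine ⟨Fin.cons (α 0 - ∑ i, a i) a, fun j => ?_⟩
    rw [Finset.sum_filter, Fin.sum_univ_succ]
    refine Fin.cases ?_ (fun j => ?_) j
    · simp
    · have := ha j
      rw [Finset.sum_filter] at this
      simpa using this

/-- The functions `∑ᵢ αᵢ log Dᵢ`, where `x = R D R†` with `R` lower unitriangular, restrict to the
linear functionals on the standard flat, and their slopes along any geodesic are given by unitary
matrices. -/
theorem exists_height {n : ℕ} (α : Fin n → ℝ) :
    ∃ F : PDMat n → ℝ, (∀ β, F (PDMat.flat 1 β) = ∑ i, α i * β i) ∧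
      ∀ (g : GL (Fin n) ℂ) (β : Fin n → ℝ) (t : ℝ), ∃ W : Matrix (Fin n) (Fin n) ℂ,
        W * Wᴴ = 1 ∧
        HasDerivAt (fun s : ℝ => F (PDMat.flat g (s • β)))
          (∑ j, α j * ∑ l, ‖W j l‖ ^ 2 * β l) t ∧
        (t = 0 → (g : Matrix (Fin n) (Fin n) ℂ) * (g : Matrix (Fin n) (Fin n) ℂ)ᴴ = 1 →
          W = g) := by
  obtain ⟨a, ha⟩ := exists_sum_le_eq α
  have hswap : ∀ k : Fin n → ℝ, ∑ i, a i * ∑ j with j ≤ i, k j = ∑ j, α j * k j := by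
    intro k
    simp only [Finset.mul_sum, Finset.sum_filter, ← ha, Finset.sum_mul]
    rw [Finset.sum_comm]
    refine Finset.sum_congr rfl fun i _ => Finset.sum_congr rfl fun j _ => ?_
    split_ifs <;> simp
  refine ⟨fun x => ∑ i, a i * logMinor i x, fun β => ?_, fun g β t => ?_⟩
  · simp only [logMinor_flat_one, hswap]
  · obtain ⟨T, hT, hT1, hTg⟩ : ∃ T : Matrix (Fin n) (Fin n) ℂ, (∀ i j, i < j → T i j = 0) ∧
        T * (PDMat.flat g (t • β)).1 * Tᴴ = 1 ∧ (t = 0 →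
          (g : Matrix (Fin n) (Fin n) ℂ) * (g : Matrix (Fin n) (Fin n) ℂ)ᴴ = 1 → T = 1) := by
      -- When the geodesic starts at the identity matrix, `T = 1` is taken explicitly, so that `W`
      -- is `g` itself; the rigidity argument needs this.
      by_cases h : t = 0 ∧ (g : Matrix (Fin n) (Fin n) ℂ) * (g : Matrix (Fin n) (Fin n) ℂ)ᴴ = 1
      · refine ⟨1, fun i j hij => one_apply_ne hij.ne, ?_, fun _ _ => rfl⟩
        simp [PDMat.flat, h.1, expDiag_zero, h.2]
      · obtain ⟨T, hT, hT1⟩ := exists_lower_conj_eq_one (PDMat.flat g (t • β)).2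
        exact ⟨T, hT, hT1, fun h1 h2 => absurd ⟨h1, h2⟩ h⟩
    have hWW : (T * (g : Matrix (Fin n) (Fin n) ℂ) * expDiag ((t / 2) • β)) *
        (T * (g : Matrix (Fin n) (Fin n) ℂ) * expDiag ((t / 2) • β))ᴴ = 1 := by
      rw [← hT1]
      have e : expDiag ((t / 2) • β) * expDiag ((t / 2) • β) = expDiag (t • β) := by
        rw [expDiag_mul, ← add_smul]; congr 2; ring
      simp only [PDMat.flat, ← e, conjTranspose_mul, expDiag_conjTranspose, Matrix.mul_assoc]
    refine ⟨_, hWW, ?_, fun h1 h2 => ?_⟩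
    · rw [← hswap]
      exact HasDerivAt.fun_sum fun i _ =>
        (hasDerivAt_logMinor hT g β t rfl hWW i).const_mul (a i)
    · rw [hTg h1 h2, h1]
      simp [expDiag_zero]

/-! ### The geometry of the space of positive definite matrices -/

theorem sum_norm_sq_row_eq_one {n : ℕ} {W : Matrix (Fin n) (Fin n) ℂ}
    (h : W * Wᴴ = 1) (j : Fin n) : ∑ l, ‖W j l‖ ^ 2 = 1 := by
  have := congrFun (congrFun h j) j
  rw [mul_apply, one_apply_eq] at this
  simp only [conjTranspose_apply, Complex.star_def, Complex.mul_conj, Complex.normSq_eq_norm_sq]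
    at this
  exact_mod_cast this

theorem sum_norm_sq_col_eq_one {n : ℕ} {W : Matrix (Fin n) (Fin n) ℂ}
    (h : W * Wᴴ = 1) (l : Fin n) : ∑ j, ‖W j l‖ ^ 2 = 1 := by
  have h' : Wᴴ * Wᴴᴴ = 1 := by rw [conjTranspose_conjTranspose]; exact mul_eq_one_comm.1 h
  simpa using sum_norm_sq_row_eq_one h' l

/-- The variance identity behind `∑ⱼ αⱼ (W diag(β) W†)ⱼⱼ ≤ ‖α‖ ‖β‖`. -/
theorem sum_norm_sq_mul_sq {n : ℕ} {W : Matrix (Fin n) (Fin n) ℂ} (h : W * Wᴴ = 1)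
    (α β : Fin n → ℝ) :
    ∑ j, ∑ l, ‖W j l‖ ^ 2 * (√(∑ i, β i ^ 2) * α j - √(∑ i, α i ^ 2) * β l) ^ 2 =
      2 * (√(∑ i, α i ^ 2) * √(∑ i, β i ^ 2)) * (√(∑ i, α i ^ 2) * √(∑ i, β i ^ 2) -
        ∑ j, α j * ∑ l, ‖W j l‖ ^ 2 * β l) := by
  have ha : √(∑ i, α i ^ 2) ^ 2 = ∑ i, α i ^ 2 :=
    Real.sq_sqrt (Finset.sum_nonneg fun i _ => sq_nonneg _)
  have hb : √(∑ i, β i ^ 2) ^ 2 = ∑ i, β i ^ 2 :=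
    Real.sq_sqrt (Finset.sum_nonneg fun i _ => sq_nonneg _)
  set a := √(∑ i, α i ^ 2)
  set b := √(∑ i, β i ^ 2)
  have e₁ : ∑ j, ∑ l, ‖W j l‖ ^ 2 * α j ^ 2 = a ^ 2 := by
    simp_rw [← Finset.sum_mul, sum_norm_sq_row_eq_one h, one_mul, ha]
  have e₂ : ∑ j, ∑ l, ‖W j l‖ ^ 2 * β l ^ 2 = b ^ 2 := by
    rw [Finset.sum_comm]
    simp_rw [← Finset.sum_mul, sum_norm_sq_col_eq_one h, one_mul, hb]
  calc _ = ∑ j, ∑ l, (b ^ 2 * (‖W j l‖ ^ 2 * α j ^ 2) + a ^ 2 * (‖W j l‖ ^ 2 * β l ^ 2) -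
        2 * a * b * (α j * (‖W j l‖ ^ 2 * β l))) :=
        Finset.sum_congr rfl fun j _ => Finset.sum_congr rfl fun l _ => by ring
    _ = b ^ 2 * a ^ 2 + a ^ 2 * b ^ 2 -
        2 * a * b * ∑ j, α j * ∑ l, ‖W j l‖ ^ 2 * β l := by
      simp only [Finset.sum_sub_distrib, Finset.sum_add_distrib, ← Finset.mul_sum, e₁, e₂]
    _ = _ := by ring

/-- The left side of the variance identity is a sum of nonnegative terms, and its factor `2 ‖α‖ ‖β‖`
can be cancelled unless one of the vectors is zero. -/
theorem sum_mul_sum_norm_sq_le {n : ℕ} {W : Matrix (Fin n) (Fin n) ℂ} (h : W * Wᴴ = 1)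
    (α β : Fin n → ℝ) :
    ∑ j, α j * ∑ l, ‖W j l‖ ^ 2 * β l ≤ √(∑ i, α i ^ 2) * √(∑ i, β i ^ 2) := by
  have key := sum_norm_sq_mul_sq h α β
  have hnn : 0 ≤ ∑ j, ∑ l, ‖W j l‖ ^ 2 *
      (√(∑ i, β i ^ 2) * α j - √(∑ i, α i ^ 2) * β l) ^ 2 :=
    Finset.sum_nonneg fun j _ => Finset.sum_nonneg fun l _ => by positivity
  rw [key] at hnn
  have hvan : ∀ γ : Fin n → ℝ, √(∑ i, γ i ^ 2) = 0 → ∀ i, γ i = 0 := by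
    intro γ hγ i
    rw [Real.sqrt_eq_zero (Finset.sum_nonneg fun i _ => sq_nonneg _),
      Finset.sum_eq_zero_iff_of_nonneg (fun i _ => sq_nonneg _)] at hγ
    exact pow_eq_zero_iff (two_ne_zero) |>.1 (hγ i (Finset.mem_univ i))
  rcases (Real.sqrt_nonneg (∑ i, α i ^ 2)).eq_or_lt with h0 | ha
  · simp [hvan α h0.symm]
  rcases (Real.sqrt_nonneg (∑ i, β i ^ 2)).eq_or_lt with h0 | hb
  · simp [hvan β h0.symm]
  by_contra! hlt
  have : 0 < 2 * (√(∑ i, α i ^ 2) * √(∑ i, β i ^ 2)) := by positivity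
  nlinarith

namespace PDMat

variable {n : ℕ}

@[ext] theorem ext {x y : PDMat n} (h : x.1 = y.1) : x = y := Subtype.ext h

theorem flat_val (g : GL (Fin n) ℂ) (α : Fin n → ℝ) :
    (flat g α).1 = (g : Matrix (Fin n) (Fin n) ℂ) * expDiag α *
      (g : Matrix (Fin n) (Fin n) ℂ)ᴴ := rfl

/-- Two points lie in a common flat. -/
theorem exists_flat (x y : PDMat n) : ∃ g β, x = flat g 0 ∧ y = flat g β := by
  obtain ⟨hu, hh, hsq⟩ := PDMat.sqrt_facts x
  set S := cfc Real.sqrt x.1 with hS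
  have hdet : IsUnit S.det := (Matrix.isUnit_iff_isUnit_det S).1 hu
  have hi : (S⁻¹)ᴴ = S⁻¹ := by rw [conjTranspose_nonsing_inv, hh]
  have hpd : (S⁻¹ * y.1 * S⁻¹).PosDef := by
    have h := (Matrix.IsUnit.posDef_star_right_conjugate_iff (x := y.1)
      ((Matrix.isUnit_nonsing_inv_iff).2 hu)).2 y.2
    simpa [star_eq_conjTranspose, hi] using h
  have hH := hpd.isHermitian
  set U : Matrix (Fin n) (Fin n) ℂ := (hH.eigenvectorUnitary).1 with hU
  have hUU : U * Uᴴ = 1 := (Unitary.mem_iff.1 hH.eigenvectorUnitary.2).2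
  have hspec : S⁻¹ * y.1 * S⁻¹ = U * expDiag (fun i => Real.log (hH.eigenvalues i)) * Uᴴ := by
    conv_lhs => rw [hH.spectral_theorem]
    rw [Unitary.conjStarAlgAut_apply, star_eq_conjTranspose]
    congr 2
    unfold expDiag
    congr 1
    ext i
    simp [Real.exp_log (hpd.eigenvalues_pos i)]
  have hUu : IsUnit U := (Matrix.isUnit_iff_isUnit_det U).2
    (IsUnit.of_mul_eq_one (Uᴴ).det (by rw [← det_mul, hUU, det_one]))
  refine ⟨(hu.mul hUu).unit, fun i => Real.log (hH.eigenvalues i), ?_, ?_⟩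
  · ext1
    rw [flat_val, IsUnit.unit_spec, expDiag_zero, Matrix.mul_one, conjTranspose_mul, hh, ← hsq]
    calc S * S = S * (U * Uᴴ) * S := by rw [hUU, Matrix.mul_one]
      _ = _ := by simp only [Matrix.mul_assoc]
  · ext1
    rw [flat_val, IsUnit.unit_spec, conjTranspose_mul, hh]
    calc y.1 = (S * S⁻¹) * y.1 * (S⁻¹ * S) := by
          rw [Matrix.mul_nonsing_inv _ hdet, Matrix.nonsing_inv_mul _ hdet, Matrix.one_mul,
            Matrix.mul_one]
      _ = S * (S⁻¹ * y.1 * S⁻¹) * S := by simp only [Matrix.mul_assoc]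
      _ = S * (U * expDiag (fun i => Real.log (hH.eigenvalues i)) * Uᴴ) * S :=
          congrArg (fun M => S * M * S) hspec
      _ = _ := by simp only [Matrix.mul_assoc]

/-- The isometric action of `GL(n, ℂ)` by congruence. -/
def act (k : GL (Fin n) ℂ) (x : PDMat n) : PDMat n :=
  ⟨(k : Matrix (Fin n) (Fin n) ℂ) * x.1 * (k : Matrix (Fin n) (Fin n) ℂ)ᴴ, by
    have h := (Matrix.IsUnit.posDef_star_right_conjugate_iff (x := x.1) k.isUnit).2 x.2
    simpa [star_eq_conjTranspose] using h⟩

theorem act_flat (k g : GL (Fin n) ℂ) (α : Fin n → ℝ) : act k (flat g α) = flat (k * g) α := by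
  ext1
  simp only [act, flat_val, Units.val_mul, conjTranspose_mul, Matrix.mul_assoc]

theorem act_act (k l : GL (Fin n) ℂ) (x : PDMat n) : act k (act l x) = act (k * l) x := by
  ext1
  simp only [act, Units.val_mul, conjTranspose_mul, Matrix.mul_assoc]

theorem act_one (x : PDMat n) : act 1 x = x := by
  ext1
  simp [act]

theorem act_injective (k : GL (Fin n) ℂ) : Function.Injective (act k) := by
  intro x y h
  have := congrArg (act k⁻¹) h
  simpa [act_act, act_one] using this

theorem dist_act (k : GL (Fin n) ℂ) (x y : PDMat n) : dist (act k x) (act k y) = dist x y := by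
  obtain ⟨g, β, rfl, rfl⟩ := exists_flat x y
  rw [act_flat, act_flat, dist_flat, dist_flat]

theorem dist_flat_zero (g : GL (Fin n) ℂ) (β : Fin n → ℝ) :
    dist (flat g 0) (flat g β) = √(∑ i, β i ^ 2) := by
  rw [dist_flat]; simp

theorem eq_of_dist_eq_zero {x y : PDMat n} (h : dist x y = 0) : x = y := by
  obtain ⟨g, β, rfl, rfl⟩ := exists_flat x y
  rw [dist_flat_zero, Real.sqrt_eq_zero (Finset.sum_nonneg fun i _ => sq_nonneg _),
    Finset.sum_eq_zero_iff_of_nonneg (fun i _ => sq_nonneg _)] at h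
  have : β = 0 := by
    ext i
    exact pow_eq_zero_iff (two_ne_zero) |>.1 (h i (Finset.mem_univ i))
  rw [this]

/-- The logarithmic Cholesky functionals are Lipschitz, and along a geodesic from `1` the extremal
slope is only attained in the standard flat. -/
theorem exists_lipschitz_height (α : Fin n → ℝ) :
    ∃ F : PDMat n → ℝ, (∀ β, F (flat 1 β) = ∑ i, α i * β i) ∧
      (∀ x y, F y - F x ≤ √(∑ i, α i ^ 2) * dist x y) ∧
      (∀ y, α ≠ 0 → F y - F (flat 1 0) = √(∑ i, α i ^ 2) * dist (flat 1 0) y →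
        y = flat 1 ((dist (flat 1 0) y / √(∑ i, α i ^ 2)) • α)) := by
  obtain ⟨F, hF, hder⟩ := exists_height α
  have hmono : ∀ (g : GL (Fin n) ℂ) (β : Fin n → ℝ), Antitone fun s : ℝ =>
      F (flat g (s • β)) - √(∑ i, α i ^ 2) * √(∑ i, β i ^ 2) * s := by
    intro g β
    have hd : ∀ t : ℝ, ∃ k, k ≤ 0 ∧ HasDerivAt (fun s : ℝ =>
        F (flat g (s • β)) - √(∑ i, α i ^ 2) * √(∑ i, β i ^ 2) * s) k t := by
      intro t
      obtain ⟨W, hW, hk, -⟩ := hder g β t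
      refine ⟨_, ?_, hk.sub ((hasDerivAt_id t).const_mul _)⟩
      rw [mul_one, sub_nonpos]
      exact sum_mul_sum_norm_sq_le hW α β
    choose k hk hk' using hd
    exact antitone_of_hasDerivAt_nonpos hk' hk
  refine ⟨F, hF, fun x y => ?_, fun y hα hy => ?_⟩
  · obtain ⟨g, β, rfl, rfl⟩ := exists_flat x y
    have := hmono g β zero_le_one
    simp only [one_smul, zero_smul, mul_one, mul_zero, sub_zero] at this
    rw [dist_flat_zero]
    linarith
  · obtain ⟨g, β, hg, rfl⟩ := exists_flat (flat 1 0) y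
    have hgg : (g : Matrix (Fin n) (Fin n) ℂ) * (g : Matrix (Fin n) (Fin n) ℂ)ᴴ = 1 := by
      have := congrArg Subtype.val hg
      rw [flat_val, flat_val, expDiag_zero] at this
      simpa using this.symm
    rw [hg, dist_flat_zero] at hy ⊢
    set b := √(∑ i, β i ^ 2) with hb
    set a := √(∑ i, α i ^ 2) with ha
    have ha0 : 0 < a := by
      apply Real.sqrt_pos.2
      obtain ⟨i, hi⟩ := Function.ne_iff.1 hα
      exact Finset.sum_pos' (fun i _ => sq_nonneg _) ⟨i, Finset.mem_univ i, by
        have : α i ≠ 0 := hi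
        positivity⟩
    -- The antitone function of `hmono` takes equal values at `0` and `1` by `hy`, so it is constant
    -- in between.
    have hlin : ∀ s ∈ Set.Icc (0 : ℝ) 1, F (flat g (s • β)) = F (flat g 0) + a * b * s := by
      intro s hs
      have h₁ := hmono g β hs.1
      have h₂ := hmono g β hs.2
      simp only [one_smul, zero_smul, mul_one, mul_zero, sub_zero] at h₁ h₂
      linarith
    obtain ⟨W, hW, hk, hWg⟩ := hder g β 0
    have hk' : HasDerivWithinAt (fun s : ℝ => F (flat g (s • β))) (a * b) (Set.Icc 0 1) 0 := by
      have h1 : HasDerivWithinAt (fun s : ℝ => F (flat g 0) + a * b * s) (a * b)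
          (Set.Icc 0 1) 0 := by
        simpa using (((hasDerivAt_id (0 : ℝ)).const_mul (a * b)).const_add
          (F (flat g 0))).hasDerivWithinAt
      exact h1.congr hlin (hlin 0 ⟨le_rfl, zero_le_one⟩)
    have heq := (uniqueDiffOn_Icc_zero_one 0 ⟨le_rfl, zero_le_one⟩).eq_deriv _ hk.hasDerivWithinAt
      hk'
    rw [hWg rfl hgg] at heq
    have hvar := sum_norm_sq_mul_sq hgg α β
    rw [← ha, ← hb, heq, sub_self, mul_zero,
      Finset.sum_eq_zero_iff_of_nonneg (fun j _ => Finset.sum_nonneg fun l _ => by positivity)]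
      at hvar
    -- The slope at time `0` is extremal, so every term of the variance identity vanishes.
    have hent : ∀ j l, (g : Matrix (Fin n) (Fin n) ℂ) j l ≠ 0 → β l = b / a * α j := by
      intro j l hjl
      have h1 := hvar j (Finset.mem_univ j)
      rw [Finset.sum_eq_zero_iff_of_nonneg (fun l _ => by positivity)] at h1
      have h2 := h1 l (Finset.mem_univ l)
      have h3 : ‖(g : Matrix (Fin n) (Fin n) ℂ) j l‖ ^ 2 ≠ 0 := by
        have := norm_ne_zero_iff.2 hjl
        positivity
      have h4 := pow_eq_zero_iff (two_ne_zero) |>.1 ((mul_eq_zero.1 h2).resolve_left h3)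
      field_simp
      linarith
    have hcomm : (g : Matrix (Fin n) (Fin n) ℂ) * expDiag β =
        expDiag ((b / a) • α) * (g : Matrix (Fin n) (Fin n) ℂ) := by
      ext j l
      rw [expDiag, expDiag, mul_diagonal, diagonal_mul, mul_comm]
      by_cases h0 : (g : Matrix (Fin n) (Fin n) ℂ) j l = 0
      · simp [h0]
      · rw [hent j l h0]; rfl
    ext1
    rw [flat_val, hcomm, Matrix.mul_assoc, hgg, flat_val]
    simp

/-- For the triangle inequality, the side from `x` to `z` is moved into the standard flat with
direction `β`. The height function of `β` grows by `‖β‖²` along it, and its Lipschitz bound on the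
other two sides gives at most `‖β‖` times their total length. -/
instance : IsPseudoDist (PDMat n) where
  dist_self x := by
    obtain ⟨g, β, h, -⟩ := exists_flat x x
    rw [h, dist_flat]
    simp
  dist_comm x y := by
    obtain ⟨g, β, rfl, rfl⟩ := exists_flat x y
    rw [dist_flat, dist_flat]
    simp
  dist_triangle x y z := by
    obtain ⟨g, β, rfl, rfl⟩ := exists_flat x z
    obtain ⟨F, hF, hL, -⟩ := exists_lipschitz_height β
    rw [← dist_act g⁻¹ _ y, ← dist_act g⁻¹ y, ← dist_act g⁻¹, act_flat, act_flat, inv_mul_cancel]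
    have h₁ := hL (flat 1 0) (act g⁻¹ y)
    have h₂ := hL (act g⁻¹ y) (flat 1 β)
    have e : F (flat 1 β) - F (flat 1 0) = √(∑ i, β i ^ 2) * √(∑ i, β i ^ 2) := by
      rw [hF, hF, Real.mul_self_sqrt (Finset.sum_nonneg fun i _ => sq_nonneg _)]
      simp [sq]
    rw [dist_flat_zero] 
    rcases (Real.sqrt_nonneg (∑ i, β i ^ 2)).eq_or_lt with h0 | hpos
    · rw [← h0]
      exact add_nonneg (dist_nonneg _ _) (dist_nonneg _ _)
    · refine le_of_mul_le_mul_left ?_ hpos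
      linarith

/-- Geodesics are unique. -/
theorem eq_flat_of_dist_add_dist {g : GL (Fin n) ℂ} {α : Fin n → ℝ} (hα : α ≠ 0) {y : PDMat n}
    (h : dist (flat g 0) y + dist y (flat g α) = dist (flat g 0) (flat g α)) :
    y = flat g ((dist (flat g 0) y / √(∑ i, α i ^ 2)) • α) := by
  obtain ⟨F, hF, hL, hE⟩ := exists_lipschitz_height α
  have hd : dist (flat g 0) y = dist (flat 1 0) (act g⁻¹ y) := by
    rw [← dist_act g⁻¹, act_flat, inv_mul_cancel]
  have hd' : dist y (flat g α) = dist (act g⁻¹ y) (flat 1 α) := by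
    rw [← dist_act g⁻¹, act_flat, inv_mul_cancel]
  have e : F (flat 1 α) - F (flat 1 0) = √(∑ i, α i ^ 2) * √(∑ i, α i ^ 2) := by
    rw [hF, hF, Real.mul_self_sqrt (Finset.sum_nonneg fun i _ => sq_nonneg _)]
    simp [sq]
  rw [hd, hd', dist_flat_zero] at h
  rw [hd]
  have h₁ := hL (flat 1 0) (act g⁻¹ y)
  have h₂ := hL (act g⁻¹ y) (flat 1 α)
  -- Equality in the triangle inequality makes both Lipschitz estimates sharp, so the rigidity
  -- statement applies to the translate of `y`.
  have h₃ := hE (act g⁻¹ y) hα (by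
    refine le_antisymm h₁ ?_
    have : dist (flat 1 0) (act g⁻¹ y) = √(∑ i, α i ^ 2) - dist (act g⁻¹ y) (flat 1 α) := by
      linarith
    rw [this, mul_sub]
    linarith)
  have h₄ := congrArg (act g) h₃
  rwa [act_act, mul_inv_cancel, act_one, act_flat, mul_one] at h₄

/-- A geodesic through two distinct points is determined by them. -/
theorem flat_smul_eq {g g' : GL (Fin n) ℂ} {α α' : Fin n → ℝ} (h0 : flat g 0 = flat g' 0)
    (h1 : flat g α = flat g' α') (s : ℝ) : flat g (s • α) = flat g' (s • α') := by
  set w : GL (Fin n) ℂ := g⁻¹ * g' with hw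
  have hg' : g' = g * w := by rw [hw, mul_inv_cancel_left]
  rw [hg', ← mul_one g, ← act_flat, mul_one, ← act_flat] at h0 h1 ⊢
  have h0' := congrArg Subtype.val (act_injective g h0)
  have h1' := congrArg Subtype.val (act_injective g h1)
  simp only [flat_val, Units.val_one, Matrix.one_mul, conjTranspose_one, Matrix.mul_one,
    expDiag_zero] at h0' h1'
  congr 1
  ext1
  simp only [flat_val, Units.val_one, Matrix.one_mul, conjTranspose_one, Matrix.mul_one]
  have hww : (w : Matrix (Fin n) (Fin n) ℂ)ᴴ * (w : Matrix (Fin n) (Fin n) ℂ) = 1 :=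
    mul_eq_one_comm.1 h0'.symm
  -- The unitary `w` intertwines the two diagonal matrices: `w i j ≠ 0` forces `αᵢ = α'ⱼ`, and this
  -- condition survives scaling by `s`.
  have hcomm : expDiag α * (w : Matrix (Fin n) (Fin n) ℂ) =
      (w : Matrix (Fin n) (Fin n) ℂ) * expDiag α' := by
    rw [h1', Matrix.mul_assoc, hww, Matrix.mul_one]
  have hcomm' : expDiag (s • α) * (w : Matrix (Fin n) (Fin n) ℂ) =
      (w : Matrix (Fin n) (Fin n) ℂ) * expDiag (s • α') := by
    ext i j
    have hij := congrFun (congrFun hcomm i) j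
    simp only [expDiag, mul_diagonal, diagonal_mul] at hij ⊢
    by_cases hz : (w : Matrix (Fin n) (Fin n) ℂ) i j = 0
    · simp [hz]
    · rw [mul_comm, mul_right_inj' hz, Complex.ofReal_inj, Real.exp_eq_exp] at hij
      simp [hij, mul_comm]
  rw [← hcomm', Matrix.mul_assoc, ← h0', Matrix.mul_one]

/-- Every constant-speed ray is of the form `t ↦ g e^{t diag α} g†`. -/
theorem exists_eq_ray (c : Ray (PDMat n)) : ∃ α g, c = ray g α := by
  set r := dist (c 0) (c 1) with hr
  rcases c.speed_nonneg.eq_or_lt with h0 | hpos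
  · obtain ⟨g, β, hg, -⟩ := exists_flat (c 0) (c 0)
    refine ⟨0, g, Ray.ext (funext fun t => ?_)⟩
    have : dist (c 0) (c t) = 0 := by rw [c.dist_zero_left, ← h0, zero_mul]
    rw [← eq_of_dist_eq_zero this, hg]
    simp [ray]
  have hseg : ∀ t : ℝ≥0, 0 < t → ∃ g α, ∀ s ≤ t, c s = flat g ((s : ℝ) • α) := by
    intro t ht
    have ht' : (0 : ℝ) < t := ht
    obtain ⟨g, β, hg0, hg1⟩ := exists_flat (c 0) (c t)
    have hd := c.dist_zero_left t
    have hd0 : √(∑ i, β i ^ 2) = r * t := by rw [← hd, hg0, hg1, dist_flat_zero]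
    have hβ : β ≠ 0 := by
      rintro rfl
      simp only [Pi.zero_apply, ne_eq, OfNat.ofNat_ne_zero, not_false_eq_true, zero_pow,
        Finset.sum_const_zero, Real.sqrt_zero] at hd0
      have : 0 < r * t := mul_pos hpos ht'
      linarith
    refine ⟨g, (t : ℝ)⁻¹ • β, fun s hs => ?_⟩
    have hs' : (s : ℝ) ≤ t := hs
    have := eq_flat_of_dist_add_dist (g := g) (y := c s) hβ (by
      rw [← hg0, ← hg1, hd, c.dist_zero_left s, c.dist_eq s t, abs_sub_comm,
        abs_of_nonneg (sub_nonneg.2 hs')]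
      ring)
    rw [this, ← hg0, c.dist_zero_left, hd0, smul_smul, ← hr]
    congr 2
    have hr0 : r ≠ 0 := hpos.ne'
    field_simp
  obtain ⟨g, α, h1⟩ := hseg 1 one_pos
  refine ⟨α, g, Ray.ext (funext fun t => ?_)⟩
  rcases le_total t 1 with ht | ht
  · rw [h1 t ht]; rfl
  -- The geodesics found on `[0, 1]` and on `[0, t]` agree at times `0` and `1`, hence at all times.
  · obtain ⟨g', α', ht'⟩ := hseg t (zero_lt_one.trans_le ht)
    have hflat : flat g ((t : ℝ) • α) = flat g' ((t : ℝ) • α') := by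
      refine flat_smul_eq ?_ ?_ t
      · have e₁ := h1 0 zero_le
        have e₂ := ht' 0 zero_le
        rw [e₁] at e₂
        simpa using e₂
      · have e₁ := h1 1 le_rfl
        have e₂ := ht' 1 ht
        rw [e₁] at e₂
        simpa using e₂
    exact (ht' t le_rfl).trans hflat.symm

end PDMat

/-! ### Points at infinity and frames -/

namespace PDMat

variable {n : ℕ}

/-- `e^{diag α}` as an element of `GL(n, ℂ)`. -/
def expGL (α : Fin n → ℝ) : GL (Fin n) ℂ where
  val := expDiag α
  inv := expDiag (-α)
  val_inv := by rw [expDiag_mul, add_neg_cancel, expDiag_zero]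
  inv_val := by rw [expDiag_mul, neg_add_cancel, expDiag_zero]

theorem flat_eq_flat_mul_expGL (g : GL (Fin n) ℂ) (α : Fin n → ℝ) :
    flat g α = flat (g * expGL ((1 / 2 : ℝ) • α)) 0 := by
  ext1
  have e : expDiag ((1 / 2 : ℝ) • α) * expDiag ((1 / 2 : ℝ) • α) = expDiag α := by
    rw [expDiag_mul, ← add_smul]; norm_num
  rw [flat_val, flat_val, ← e, expDiag_zero, Matrix.mul_one, Units.val_mul, conjTranspose_mul]
  simp only [expGL, expDiag_conjTranspose, Matrix.mul_assoc]

theorem trace_mul_conjTranspose_re (N : Matrix (Fin n) (Fin n) ℂ) :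
    (trace (N * Nᴴ)).re = ∑ i, ∑ j, ‖N i j‖ ^ 2 := by
  simp only [trace, diag_apply, mul_apply, conjTranspose_apply, Complex.re_sum]
  refine Finset.sum_congr rfl fun i _ => Finset.sum_congr rfl fun j _ => ?_
  rw [Complex.star_def, Complex.mul_conj, Complex.ofReal_re, Complex.normSq_eq_norm_sq]

/-- The eigenvalues `e^{βᵢ}` of `h h†` are at most its trace, and their inverses are at most the
trace of the inverse matrix. So `|βᵢ| ≤ log S`. -/
theorem dist_one_flat_le (h : GL (Fin n) ℂ) {S : ℝ}
    (hS : ∑ i, ∑ j, ‖(h : Matrix (Fin n) (Fin n) ℂ) i j‖ ^ 2 ≤ S)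
    (hS' : ∑ i, ∑ j, ‖((h⁻¹ : GL (Fin n) ℂ) : Matrix (Fin n) (Fin n) ℂ) i j‖ ^ 2 ≤ S) :
    dist (flat 1 0) (flat h 0) ≤ √(n * Real.log S ^ 2) := by
  obtain ⟨w, β, hw, hβ⟩ := exists_flat (flat 1 0) (flat h 0)
  have h1 := congrArg Subtype.val hw
  have h2 := congrArg Subtype.val hβ
  simp only [flat_val, expDiag_zero, Matrix.mul_one, Units.val_one, conjTranspose_one] at h1 h2
  have h1' : (w : Matrix (Fin n) (Fin n) ℂ)ᴴ * (w : Matrix (Fin n) (Fin n) ℂ) = 1 :=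
    mul_eq_one_comm.1 h1.symm
  have htr : ∀ γ : Fin n → ℝ, (trace ((w : Matrix (Fin n) (Fin n) ℂ) * expDiag γ *
      (w : Matrix (Fin n) (Fin n) ℂ)ᴴ)).re = ∑ i, Real.exp (γ i) := by
    intro γ
    rw [trace_mul_cycle, h1', Matrix.one_mul, expDiag, trace_diagonal, Complex.re_sum]
    simp only [Complex.ofReal_re]
  have h3 : ((h⁻¹ : GL (Fin n) ℂ) : Matrix (Fin n) (Fin n) ℂ)ᴴ *
      ((h⁻¹ : GL (Fin n) ℂ) : Matrix (Fin n) (Fin n) ℂ) =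
      (w : Matrix (Fin n) (Fin n) ℂ) * expDiag (-β) * (w : Matrix (Fin n) (Fin n) ℂ)ᴴ := by
    have hh : ((h⁻¹ : GL (Fin n) ℂ) : Matrix (Fin n) (Fin n) ℂ) *
        (h : Matrix (Fin n) (Fin n) ℂ) = 1 := by
      rw [← Units.val_mul, inv_mul_cancel, Units.val_one]
    have hh' : (h : Matrix (Fin n) (Fin n) ℂ)ᴴ *
        ((h⁻¹ : GL (Fin n) ℂ) : Matrix (Fin n) (Fin n) ℂ)ᴴ = 1 := by
      rw [← conjTranspose_mul, hh, conjTranspose_one]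
    have e1 : ((h⁻¹ : GL (Fin n) ℂ) : Matrix (Fin n) (Fin n) ℂ)ᴴ *
        ((h⁻¹ : GL (Fin n) ℂ) : Matrix (Fin n) (Fin n) ℂ) *
        ((h : Matrix (Fin n) (Fin n) ℂ) * (h : Matrix (Fin n) (Fin n) ℂ)ᴴ) = 1 := by
      calc _ = ((h⁻¹ : GL (Fin n) ℂ) : Matrix (Fin n) (Fin n) ℂ)ᴴ *
            (((h⁻¹ : GL (Fin n) ℂ) : Matrix (Fin n) (Fin n) ℂ) *
              (h : Matrix (Fin n) (Fin n) ℂ)) * (h : Matrix (Fin n) (Fin n) ℂ)ᴴ := by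
            simp only [Matrix.mul_assoc]
        _ = 1 := by rw [hh, Matrix.mul_one]; exact mul_eq_one_comm.1 hh'
    have e2 : ((h : Matrix (Fin n) (Fin n) ℂ) * (h : Matrix (Fin n) (Fin n) ℂ)ᴴ) *
        ((w : Matrix (Fin n) (Fin n) ℂ) * expDiag (-β) * (w : Matrix (Fin n) (Fin n) ℂ)ᴴ) = 1 := by
      rw [h2]
      calc _ = (w : Matrix (Fin n) (Fin n) ℂ) * expDiag β *
            ((w : Matrix (Fin n) (Fin n) ℂ)ᴴ * (w : Matrix (Fin n) (Fin n) ℂ)) * expDiag (-β) *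
            (w : Matrix (Fin n) (Fin n) ℂ)ᴴ := by simp only [Matrix.mul_assoc]
        _ = 1 := by
          rw [h1', Matrix.mul_one, Matrix.mul_assoc _ (expDiag β), expDiag_mul, add_neg_cancel,
            expDiag_zero, Matrix.mul_one, ← h1]
    exact left_inv_eq_right_inv e1 e2
  have hup : ∀ i, Real.exp (β i) ≤ S := fun i => by
    refine le_trans ?_ hS
    rw [← trace_mul_conjTranspose_re, h2, htr]
    exact Finset.single_le_sum (f := fun i => Real.exp (β i)) (fun i _ => (Real.exp_pos _).le)
      (Finset.mem_univ i)
  have hlow : ∀ i, Real.exp (-β i) ≤ S := fun i => by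
    refine le_trans ?_ hS'
    rw [← trace_mul_conjTranspose_re, trace_mul_comm, h3, htr]
    exact Finset.single_le_sum (f := fun i => Real.exp ((-β) i)) (fun i _ => (Real.exp_pos _).le)
      (Finset.mem_univ i)
  rw [hβ, hw, dist_flat_zero]
  apply Real.sqrt_le_sqrt
  calc ∑ i, β i ^ 2 ≤ ∑ _i : Fin n, Real.log S ^ 2 := by
        refine Finset.sum_le_sum fun i _ => ?_
        have hSpos : 0 < S := (Real.exp_pos _).trans_le (hup i)
        have a1 := (Real.le_log_iff_exp_le hSpos).2 (hup i)
        have a2 := (Real.le_log_iff_exp_le hSpos).2 (hlow i)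
        exact sq_le_sq' (by linarith) a1
    _ = n * Real.log S ^ 2 := by simp

theorem exists_eq_flagPoint (p : BoundaryCone (PDMat n)) : ∃ α g, p = flagPoint α g := by
  obtain ⟨c, rfl⟩ := Quot.mk_surjective p
  obtain ⟨α, g, rfl⟩ := exists_eq_ray c
  exact ⟨α, g, rfl⟩

end PDMat

open PDMat

section Frames

variable {n : ℕ}

/-- Conjugation multiplies the entry at `(i, j)` by `e^{(t/2)(αⱼ - αᵢ)}`, which is at most `1`
wherever `b` has a nonzero entry. -/
theorem norm_expDiag_conj_le {α : Fin n → ℝ} {b : Matrix (Fin n) (Fin n) ℂ}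
    (hb : ∀ i j, b i j ≠ 0 → α j ≤ α i) (t : ℝ≥0) (i j : Fin n) :
    ‖(expDiag (-((t / 2 : ℝ) • α)) * b * expDiag ((t / 2 : ℝ) • α)) i j‖ ≤ ‖b i j‖ := by
  rw [expDiag, expDiag, mul_diagonal, diagonal_mul]
  by_cases h : b i j = 0
  · simp [h]
  · rw [norm_mul, norm_mul, Complex.norm_real, Complex.norm_real, Real.norm_eq_abs,
      Real.norm_eq_abs, abs_of_pos (Real.exp_pos _), abs_of_pos (Real.exp_pos _), mul_right_comm,
      ← Real.exp_add]
    refine mul_le_of_le_one_left (norm_nonneg _) (Real.exp_le_one_iff.2 ?_)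
    simp only [Pi.neg_apply, Pi.smul_apply, smul_eq_mul]
    have := hb i j h
    have ht : (0 : ℝ) ≤ t := t.coe_nonneg
    nlinarith

/-- The parabolic subgroup of `α` fixes `α · [g]`. -/
theorem flagPoint_mul {α : Fin n → ℝ} (g b : GL (Fin n) ℂ)
    (hb : ∀ i j, (b : Matrix (Fin n) (Fin n) ℂ) i j ≠ 0 → α j ≤ α i)
    (hb' : ∀ i j, ((b⁻¹ : GL (Fin n) ℂ) : Matrix (Fin n) (Fin n) ℂ) i j ≠ 0 → α j ≤ α i) :
    flagPoint α (g * b) = flagPoint α g := by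
  refine (BoundaryCone.mk_eq_mk.2 ⟨√(n * Real.log
    ((∑ i, ∑ j, ‖(b : Matrix (Fin n) (Fin n) ℂ) i j‖ ^ 2) +
      ∑ i, ∑ j, ‖((b⁻¹ : GL (Fin n) ℂ) : Matrix (Fin n) (Fin n) ℂ) i j‖ ^ 2) ^ 2),
    fun t => ?_⟩).symm
  change dist (flat g ((t : ℝ) • α)) (flat (g * b) ((t : ℝ) • α)) ≤ _
  -- After an isometry, the distance at time `t` is that from the identity to the point of `e⁻¹ b
  -- e`. The entries of this matrix and of its inverse stay bounded in `t`.
  rw [flat_eq_flat_mul_expGL, flat_eq_flat_mul_expGL (g * b),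
    ← dist_act (g * expGL ((1 / 2 : ℝ) • (t : ℝ) • α))⁻¹, act_flat, act_flat, inv_mul_cancel]
  set e := expGL ((1 / 2 : ℝ) • (t : ℝ) • α) with he
  have hs : (1 / 2 : ℝ) • (t : ℝ) • α = (t / 2 : ℝ) • α := by
    rw [smul_smul]; congr 1; ring
  have e1 : (g * e)⁻¹ * (g * b * e) = e⁻¹ * b * e := by group
  have e2 : (e⁻¹ * b * e)⁻¹ = e⁻¹ * b⁻¹ * e := by group
  have hv : ∀ c : GL (Fin n) ℂ, ((e⁻¹ * c * e : GL (Fin n) ℂ) : Matrix (Fin n) (Fin n) ℂ) =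
      expDiag (-((t / 2 : ℝ) • α)) * (c : Matrix (Fin n) (Fin n) ℂ) *
        expDiag ((t / 2 : ℝ) • α) := by
    intro c
    rw [he, hs]
    rfl
  rw [e1]
  have nn : ∀ c : Matrix (Fin n) (Fin n) ℂ, 0 ≤ ∑ i, ∑ j, ‖c i j‖ ^ 2 := fun c =>
    Finset.sum_nonneg fun i _ => Finset.sum_nonneg fun j _ => by positivity
  have hle : ∀ c : GL (Fin n) ℂ,
      (∀ i j, (c : Matrix (Fin n) (Fin n) ℂ) i j ≠ 0 → α j ≤ α i) →
      ∑ i, ∑ j, ‖((e⁻¹ * c * e : GL (Fin n) ℂ) : Matrix (Fin n) (Fin n) ℂ) i j‖ ^ 2 ≤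
        ∑ i, ∑ j, ‖(c : Matrix (Fin n) (Fin n) ℂ) i j‖ ^ 2 := by
    intro c hc
    refine Finset.sum_le_sum fun i _ => Finset.sum_le_sum fun j _ => ?_
    rw [hv]
    exact pow_le_pow_left₀ (norm_nonneg _) (norm_expDiag_conj_le hc t i j) 2
  refine dist_one_flat_le _ ?_ ?_
  · have := nn ((b⁻¹ : GL (Fin n) ℂ) : Matrix (Fin n) (Fin n) ℂ)
    linarith [hle b hb]
  · rw [e2]
    have := nn (b : Matrix (Fin n) (Fin n) ℂ)
    linarith [hle b⁻¹ hb']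

theorem inv_upperTriangular {b : GL (Fin n) ℂ}
    (hb : ∀ i j, j < i → (b : Matrix (Fin n) (Fin n) ℂ) i j = 0) :
    ∀ i j, j < i → ((b⁻¹ : GL (Fin n) ℂ) : Matrix (Fin n) (Fin n) ℂ) i j = 0 := by
  intro i j hij
  have := b.invertible
  have hbt : BlockTriangular (b : Matrix (Fin n) (Fin n) ℂ) id := fun i j h => hb i j h
  have h := blockTriangular_inv_of_blockTriangular hbt
  rw [Matrix.coe_units_inv]
  exact h hij

theorem flagPoint_mul_of_upperTriangular {α : Fin n → ℝ} (hα : Antitone α) (g : GL (Fin n) ℂ)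
    {b : GL (Fin n) ℂ} (hb : ∀ i j, j < i → (b : Matrix (Fin n) (Fin n) ℂ) i j = 0) :
    flagPoint α (g * b) = flagPoint α g :=
  flagPoint_mul g b (fun i j h => hα (not_lt.1 fun hlt => h (hb i j hlt)))
    fun i j h => hα (not_lt.1 fun hlt => h (inv_upperTriangular hb i j hlt))

/-- Permuting the frame. -/
theorem flagPoint_perm (α : Fin n → ℝ) {g k : GL (Fin n) ℂ} (σ : Equiv.Perm (Fin n))
    (h : ∀ i j, (g : Matrix (Fin n) (Fin n) ℂ) i j = (k : Matrix (Fin n) (Fin n) ℂ) i (σ j)) :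
    flagPoint α g = flagPoint (α ∘ σ.symm) k := by
  have hflat : ∀ γ : Fin n → ℝ, flat g γ = flat k (γ ∘ σ.symm) := by
    intro γ
    ext1
    ext a b
    simp only [flat_val, expDiag, mul_apply, diagonal_apply, conjTranspose_apply, mul_ite, mul_zero,
      Finset.sum_ite_eq', Finset.mem_univ, if_true, h]
    refine Fintype.sum_equiv σ _ _ fun j => ?_
    simp
  unfold flagPoint
  congr 1
  exact Ray.ext (funext fun t => hflat _)

theorem exists_perm_frame (g : GL (Fin n) ℂ) (σ : Equiv.Perm (Fin n)) : ∃ k : GL (Fin n) ℂ,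
    ∀ i j, (k : Matrix (Fin n) (Fin n) ℂ) i j = (g : Matrix (Fin n) (Fin n) ℂ) i (σ j) := by
  have hu : IsUnit ((g : Matrix (Fin n) (Fin n) ℂ).submatrix (Equiv.refl _) σ) :=
    (Matrix.isUnit_submatrix_equiv (Equiv.refl _) σ).2 g.isUnit
  exact ⟨hu.unit, fun i j => rfl⟩

theorem exists_antitone_flagPoint (p : BoundaryCone (PDMat n)) :
    ∃ (α : Fin n → ℝ) (g : GL (Fin n) ℂ), Antitone α ∧ p = flagPoint α g := by
  obtain ⟨α, g, rfl⟩ := exists_eq_flagPoint p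
  set σ := Tuple.sort (-α) with hσ
  have hmono : Monotone ((-α) ∘ σ) := Tuple.monotone_sort (-α)
  obtain ⟨k, hk⟩ := exists_perm_frame g σ
  refine ⟨α ∘ σ, k, fun i j hij => neg_le_neg_iff.1 (hmono hij), ?_⟩
  rw [flagPoint_perm (α ∘ σ) σ hk]
  congr 1
  ext i
  simp

/-- Two complete flags have a common adapted basis (the Bruhat decomposition). -/
theorem exists_bruhat (M : GL (Fin n) ℂ) : ∃ (σ : Equiv.Perm (Fin n)) (u : GL (Fin n) ℂ),
    (∀ i j, j < i → (u : Matrix (Fin n) (Fin n) ℂ) i j = 0) ∧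
    (∀ i j, σ j < i → ((M * u : GL (Fin n) ℂ) : Matrix (Fin n) (Fin n) ℂ) i j = 0) := by
  set A : Matrix (Fin n) (Fin n) ℂ := M.1 with hA
  -- `c` is a candidate for the `j`-th column of a unitriangular matrix, and `A c` vanishes below
  -- row `m`. For each `j` the least such `m` is taken.
  let P : Fin n → Fin n → (Fin n → ℂ) → Prop := fun j m c =>
    c j = 1 ∧ (∀ i, j < i → c i = 0) ∧ ∀ i, m < i → (A *ᵥ c) i = 0
  have hlast : ∀ j c, c j = 1 → (∀ i, j < i → c i = 0) →
      ∃ m, P j m c ∧ (A *ᵥ c) m ≠ 0 := by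
    intro j c hc hc'
    have hne : A *ᵥ c ≠ 0 := by
      intro h0
      have : c = 0 := by
        have h1 : (A⁻¹ * A) *ᵥ c = 0 := by rw [← mulVec_mulVec, h0, mulVec_zero]
        rwa [Matrix.nonsing_inv_mul _ ((Matrix.isUnit_iff_isUnit_det _).1 M.isUnit),
          one_mulVec] at h1
      rw [this] at hc
      exact zero_ne_one hc
    obtain ⟨i, hi⟩ := Function.ne_iff.1 hne
    obtain ⟨m, hm, hmax⟩ := (Finset.univ.filter fun i => (A *ᵥ c) i ≠ 0).exists_max_image id
      ⟨i, by simpa using hi⟩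
    refine ⟨m, ⟨hc, hc', fun i him => ?_⟩, by simpa using hm⟩
    by_contra h
    exact absurd (hmax i (by simpa using h)) (not_le.2 him)
  have hex : ∀ j, ∃ m c, P j m c ∧ ∀ m' c', P j m' c' → m ≤ m' := by
    intro j
    obtain ⟨m₀, h₀, -⟩ := hlast j (Pi.single j 1) (by simp)
      (fun i hi => Pi.single_eq_of_ne hi.ne' _)
    obtain ⟨m, ⟨c, hc⟩, hmin⟩ := (Set.toFinite {m | ∃ c, P j m c}).exists_minimal ⟨m₀, _, h₀⟩
    refine ⟨m, c, hc, fun m' c' h' => ?_⟩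
    rcases le_total m m' with h | h
    · exact h
    · exact hmin ⟨c', h'⟩ h
  choose m c hP hmin using hex
  have hpiv : ∀ j, (A *ᵥ c j) (m j) ≠ 0 := by
    intro j
    obtain ⟨k, hk, hk'⟩ := hlast j (c j) (hP j).1 (hP j).2.1
    have h1 := hmin j k _ hk
    rcases h1.eq_or_lt with h | h
    · rwa [h]
    · exact absurd ((hP j).2.2 k h) hk'
  -- If two columns had the same pivot row, subtracting a multiple of the earlier column from the
  -- later one would give the later one a smaller pivot row.
  have hne : ∀ j k, j < k → m j ≠ m k := by
    intro j k hjk hm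
    set l := (A *ᵥ c k) (m k) / (A *ᵥ c j) (m j) with hl
    obtain ⟨i, hi, hi'⟩ := hlast k (c k - l • c j)
      (by simp [(hP k).1, (hP j).2.1 k hjk])
      (fun i hi => by simp [(hP k).2.1 i hi, (hP j).2.1 i (hjk.trans hi)])
    have hle := hmin k i _ hi
    rw [mulVec_sub, mulVec_smul] at hi'
    apply hi'
    rcases hle.eq_or_lt with h | h
    · have := hpiv j
      rw [← h, Pi.sub_apply, Pi.smul_apply, smul_eq_mul, hl, ← hm]
      field_simp
      ring
    · rw [Pi.sub_apply, Pi.smul_apply, (hP k).2.2 i h, (hP j).2.2 i (hm ▸ h)]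
      simp
  have hinj : Function.Injective m := by
    intro j k hjk
    rcases lt_trichotomy j k with h | h | h
    · exact absurd hjk (hne j k h)
    · exact h
    · exact absurd hjk.symm (hne k j h)
  set U : Matrix (Fin n) (Fin n) ℂ := of fun i j => c j i with hU
  have hdet : U.det = 1 := by
    rw [det_of_isUpperTriangular (M := U) (fun i j h => (hP j).2.1 i h)]
    exact Finset.prod_eq_one fun j _ => (hP j).1
  refine ⟨Equiv.ofBijective m (Finite.injective_iff_bijective.1 hinj),
    ((Matrix.isUnit_iff_isUnit_det U).2 (by rw [hdet]; exact isUnit_one)).unit,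
    fun i j h => (hP j).2.1 i h, fun i j h => (hP j).2.2 i h⟩

/-- Any two points of the boundary cone lie in a common flat, compatibly with a chamber. -/
theorem exists_common_frame (g : GL (Fin n) ℂ) (p : BoundaryCone (PDMat n)) :
    ∃ (k : GL (Fin n) ℂ) (γ : Fin n → ℝ),
      (∀ α : Fin n → ℝ, Antitone α → flagPoint α g = flagPoint α k) ∧ p = flagPoint γ k := by
  obtain ⟨γ, h, hγ, rfl⟩ := exists_antitone_flagPoint p
  obtain ⟨σ, u, hu, hσ⟩ := exists_bruhat (g⁻¹ * h)
  obtain ⟨k, hk⟩ := exists_perm_frame (h * u) σ.symm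
  refine ⟨k, γ ∘ σ.symm, fun α hα => ?_, ?_⟩
  · have hk' : k = g * (g⁻¹ * k) := by group
    rw [hk']
    -- The columns of `h * u` are reordered by their pivots relative to `g`, which makes `g⁻¹ * k`
    -- upper triangular.
    refine (flagPoint_mul_of_upperTriangular hα g fun i j hji => ?_).symm
    have : ((g⁻¹ * k : GL (Fin n) ℂ) : Matrix (Fin n) (Fin n) ℂ) i j =
        ((g⁻¹ * h * u : GL (Fin n) ℂ) : Matrix (Fin n) (Fin n) ℂ) i (σ.symm j) := by
      rw [mul_assoc, Units.val_mul, Units.val_mul g⁻¹, mul_apply, mul_apply]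
      exact Finset.sum_congr rfl fun l _ => by rw [hk]
    rw [this]
    exact hσ _ _ (by simpa using hji)
  · rw [← flagPoint_mul_of_upperTriangular hγ h hu]
    exact flagPoint_perm γ σ fun i j => by rw [hk]; simp

/-! ### Inner products and norms on the boundary cone, and the boundary of the product. -/

theorem dist_ray_sq (g : GL (Fin n) ℂ) (α β : Fin n → ℝ) (s t : ℝ≥0) :
    dist (ray g α s) (ray g β t) ^ 2 =
      (∑ i, α i ^ 2) * s ^ 2 + (∑ i, β i ^ 2) * t ^ 2 - 2 * (∑ i, α i * β i) * s * t := by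
  change dist (flat g _) (flat g _) ^ 2 = _
  rw [dist_flat, Real.sq_sqrt (Finset.sum_nonneg fun i _ => sq_nonneg _), Finset.mul_sum,
    Finset.sum_mul, Finset.sum_mul, Finset.sum_mul, Finset.sum_mul, ← Finset.sum_add_distrib,
    ← Finset.sum_sub_distrib]
  refine Finset.sum_congr rfl fun i _ => ?_
  simp only [Pi.smul_apply, smul_eq_mul]
  ring

theorem ray_zero (g : GL (Fin n) ℂ) (α : Fin n → ℝ) : ray g α 0 = flat g 0 := by
  simp [ray]

theorem inner_flagPoint (g : GL (Fin n) ℂ) (α β : Fin n → ℝ) :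
    BoundaryCone.inner (flagPoint α g) (flagPoint β g) = ∑ i, α i * β i :=
  BoundaryCone.inner_mk (by rw [ray_zero, ray_zero]) (dist_ray_sq g α β)

/-- In each factor the two classes lie in a common flat. The product of these flats is Euclidean,
and there the dot products add. -/
theorem inner_pairPoint (p p' q q' : BoundaryCone (PDMat n)) :
    BoundaryCone.inner (pairPoint p q) (pairPoint p' q') =
      BoundaryCone.inner p p' + BoundaryCone.inner q q' := by
  obtain ⟨α, g, hα, rfl⟩ := exists_antitone_flagPoint p
  obtain ⟨β, h, hβ, rfl⟩ := exists_antitone_flagPoint q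
  obtain ⟨k, γ, hk, rfl⟩ := exists_common_frame g p'
  obtain ⟨l, δ, hl, rfl⟩ := exists_common_frame h q'
  rw [hk α hα, hl β hβ, inner_flagPoint, inner_flagPoint]
  refine BoundaryCone.inner_mk (c := Ray.pair (ray k α) (ray l β))
    (c' := Ray.pair (ray k γ) (ray l δ)) (a := ∑ i, α i ^ 2 + ∑ i, β i ^ 2)
    (b := ∑ i, γ i ^ 2 + ∑ i, δ i ^ 2) ?_ fun s t => ?_
  · change WithLp.toLp 2 (_, _) = WithLp.toLp 2 (_, _)
    rw [ray_zero, ray_zero, ray_zero, ray_zero]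
  · change dist (WithLp.toLp 2 (_, _)) (WithLp.toLp 2 (_, _)) ^ 2 = _
    rw [l2_dist, Real.sq_sqrt (by positivity), dist_ray_sq, dist_ray_sq]
    ring

theorem norm_flagPoint (g : GL (Fin n) ℂ) (α : Fin n → ℝ) :
    (flagPoint α g).norm = √(∑ i, α i ^ 2) := by
  unfold flagPoint
  rw [BoundaryCone.norm_mk]
  change dist (flat g _) (flat g _) = _
  simp [dist_flat]

theorem norm_pairPoint_flagPoint (g h : GL (Fin n) ℂ) (α β : Fin n → ℝ) :
    (pairPoint (flagPoint α g) (flagPoint β h)).norm = √(∑ i, α i ^ 2 + ∑ i, β i ^ 2) := by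
  change (BoundaryCone.mk (Ray.pair (ray g α) (ray h β))).norm = _
  rw [BoundaryCone.norm_mk]
  change dist (WithLp.toLp 2 (flat g _, flat h _)) (WithLp.toLp 2 (flat g _, flat h _)) = _
  rw [l2_dist, dist_flat, dist_flat, Real.sq_sqrt (Finset.sum_nonneg fun i _ => sq_nonneg _),
    Real.sq_sqrt (Finset.sum_nonneg fun i _ => sq_nonneg _)]
  simp

theorem pairPoint_bijective : Function.Bijective
    (fun z : BoundaryCone (PDMat n) × BoundaryCone (PDMat n) => pairPoint z.1 z.2) := by
  constructor
  · rintro ⟨p, q⟩ ⟨p', q'⟩ h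
    obtain ⟨c, rfl⟩ := Quot.mk_surjective p
    obtain ⟨c', rfl⟩ := Quot.mk_surjective p'
    obtain ⟨b, rfl⟩ := Quot.mk_surjective q
    obtain ⟨b', rfl⟩ := Quot.mk_surjective q'
    change BoundaryCone.mk (Ray.pair c b) = BoundaryCone.mk (Ray.pair c' b') at h
    rw [BoundaryCone.mk_eq_mk, Ray.pair_asymptotic_iff] at h
    exact Prod.ext (BoundaryCone.mk_eq_mk.2 h.1) (BoundaryCone.mk_eq_mk.2 h.2)
  · intro u
    obtain ⟨c, rfl⟩ := Quot.mk_surjective u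
    obtain ⟨c₁, c₂, rfl⟩ := c.exists_eq_pair
    exact ⟨(BoundaryCone.mk c₁, BoundaryCone.mk c₂), rfl⟩

/-! ### Subspaces as points at infinity -/

/-- The span of the first `k` columns of `g`. -/
def spanCols (g : GL (Fin n) ℂ) (k : ℕ) : Submodule ℂ (Fin n → ℂ) :=
  Submodule.span ℂ {v | ∃ j : Fin n, (j : ℕ) < k ∧
    v = fun i => (g : Matrix (Fin n) (Fin n) ℂ) i j}

theorem finrank_spanCols (g : GL (Fin n) ℂ) {k : ℕ} (hk : k ≤ n) :
    Module.finrank ℂ (spanCols g k) = k := by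
  have hli : LinearIndependent ℂ (fun j : Fin n => (g : Matrix (Fin n) (Fin n) ℂ).col j) :=
    Matrix.linearIndependent_cols_of_isUnit g.isUnit
  have hset : {v | ∃ j : Fin n, (j : ℕ) < k ∧
      v = fun i => (g : Matrix (Fin n) (Fin n) ℂ) i j} =
      Set.range ((fun j : Fin n => (g : Matrix (Fin n) (Fin n) ℂ).col j) ∘ Fin.castLE hk) := by
    ext v
    constructor
    · rintro ⟨j, hj, rfl⟩
      exact ⟨⟨j, hj⟩, rfl⟩
    · rintro ⟨j, rfl⟩
      exact ⟨Fin.castLE hk j, j.2, rfl⟩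
  rw [spanCols, hset, finrank_span_eq_card (hli.comp _ (Fin.castLE_injective hk)),
    Fintype.card_fin]

theorem inv_mulVec_of_mem_spanCols {g : GL (Fin n) ℂ} {k : ℕ} {v : Fin n → ℂ}
    (hv : v ∈ spanCols g k) {i : Fin n} (hi : k ≤ i) :
    (((g⁻¹ : GL (Fin n) ℂ) : Matrix (Fin n) (Fin n) ℂ) *ᵥ v) i = 0 := by
  induction hv using Submodule.span_induction with
  | mem x hx =>
    obtain ⟨j, hj, rfl⟩ := hx
    have h : ((g⁻¹ : GL (Fin n) ℂ) : Matrix (Fin n) (Fin n) ℂ) *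
        (g : Matrix (Fin n) (Fin n) ℂ) = 1 := by
      rw [← Units.val_mul, inv_mul_cancel, Units.val_one]
    have h' := congrFun (congrFun h i) j
    rw [one_apply_ne (by rintro rfl; omega)] at h'
    exact h'
  | zero => simp
  | add x y _ _ hx hy => rw [mulVec_add, Pi.add_apply, hx, hy, add_zero]
  | smul a x _ hx => rw [mulVec_smul, Pi.smul_apply, hx, smul_zero]

/-- The matrix `g'⁻¹ g` preserves the span of the first `k` coordinate vectors, so it lies in the
parabolic subgroup. Hence the frame chosen in `subspacePoint` does not matter. -/
theorem flagPoint_eq_of_spanCols_eq {g g' : GL (Fin n) ℂ} {k : ℕ}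
    (h : spanCols g k = spanCols g' k) :
    flagPoint (fun i => if (i : ℕ) < k then 1 else 0) g =
      flagPoint (fun i => if (i : ℕ) < k then 1 else 0) g' := by
  have hb : ∀ g g' : GL (Fin n) ℂ, spanCols g k = spanCols g' k → ∀ i j : Fin n,
      ((g'⁻¹ * g : GL (Fin n) ℂ) : Matrix (Fin n) (Fin n) ℂ) i j ≠ 0 →
      (if (j : ℕ) < k then (1 : ℝ) else 0) ≤ if (i : ℕ) < k then 1 else 0 := by
    intro g g' h i j hij
    split_ifs with h1 h2
    · exact le_rfl
    · exfalso
      apply hij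
      have hmem : (fun i => (g : Matrix (Fin n) (Fin n) ℂ) i j) ∈ spanCols g' k := by
        rw [← h]
        exact Submodule.subset_span ⟨j, h1, rfl⟩
      exact inv_mulVec_of_mem_spanCols hmem (not_lt.1 h2)
    · exact zero_le_one
    · exact le_rfl
  have e : g = g' * (g'⁻¹ * g) := by group
  conv_lhs => rw [e]
  refine flagPoint_mul g' _ (hb g g' h) ?_
  rw [_root_.mul_inv_rev, inv_inv]
  exact hb g' g h.symm

theorem subspacePoint_spanCols (g : GL (Fin n) ℂ) {k : ℕ} (hk : k ≤ n) :
    subspacePoint (spanCols g k) = flagPoint (fun i => if (i : ℕ) < k then 1 else 0) g := by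
  have key : ∀ (g' : GL (Fin n) ℂ) (k' : ℕ), k' = k → spanCols g' k' = spanCols g k →
      flagPoint (fun i => if (i : ℕ) < k' then 1 else 0) g' =
        flagPoint (fun i => if (i : ℕ) < k then 1 else 0) g := by
    rintro g' _ rfl h
    exact flagPoint_eq_of_spanCols_eq h
  exact key _ _ (finrank_spanCols g hk) (exists_adapted (spanCols g k)).choose_spec

theorem subspacePoint_top (g : GL (Fin n) ℂ) : subspacePoint ⊤ = flagPoint 1 g := by
  have h : spanCols g n = ⊤ := Submodule.eq_top_of_finrank_eq (by simp [finrank_spanCols])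
  rw [← h, subspacePoint_spanCols g le_rfl]
  congr 1
  ext i
  simp

theorem inner_subspacePoint_spanCols (g : GL (Fin n) ℂ) (γ : Fin n → ℝ) {k : ℕ} (hk : k ≤ n) :
    BoundaryCone.inner (subspacePoint (spanCols g k)) (flagPoint γ g) =
      ∑ i : Fin n, if (i : ℕ) < k then γ i else 0 := by
  rw [subspacePoint_spanCols g hk, inner_flagPoint]
  exact Finset.sum_congr rfl fun i _ => by split_ifs <;> simp

theorem inner_subspacePoint_top (g : GL (Fin n) ℂ) (γ : Fin n → ℝ) :
    BoundaryCone.inner (subspacePoint ⊤) (flagPoint γ g) = ∑ i, γ i := by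
  rw [subspacePoint_top g, inner_flagPoint]
  simp

end Frames

/-! ### The recession function of the scaling function -/

/-- By cyclicity the trace is that of `e^α N e^β N†` with `N = g† A h`. -/
theorem trace_flat_mul {n : ℕ} (g h : GL (Fin n) ℂ) (α β : Fin n → ℝ)
    (A : Matrix (Fin n) (Fin n) ℂ) :
    (trace ((flat g α).1 * A * (flat h β).1 * Aᴴ)).re =
      ∑ i, ∑ j, Real.exp (α i + β j) * ‖((g : Matrix (Fin n) (Fin n) ℂ)ᴴ * A *
        (h : Matrix (Fin n) (Fin n) ℂ)) i j‖ ^ 2 := by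
  set N := (g : Matrix (Fin n) (Fin n) ℂ)ᴴ * A * (h : Matrix (Fin n) (Fin n) ℂ) with hN
  have e : trace ((flat g α).1 * A * (flat h β).1 * Aᴴ) =
      trace (expDiag α * N * expDiag β * Nᴴ) := by
    have e1 : (flat g α).1 * A * (flat h β).1 * Aᴴ = (g : Matrix (Fin n) (Fin n) ℂ) *
        (expDiag α * (g : Matrix (Fin n) (Fin n) ℂ)ᴴ * A * (h : Matrix (Fin n) (Fin n) ℂ) *
          expDiag β * (h : Matrix (Fin n) (Fin n) ℂ)ᴴ * Aᴴ) := by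
      simp only [flat_val, Matrix.mul_assoc]
    rw [e1, trace_mul_comm]
    simp only [hN, conjTranspose_mul, conjTranspose_conjTranspose, Matrix.mul_assoc]
  rw [e]
  simp only [trace, diag_apply, mul_apply (N := Nᴴ), expDiag, mul_diagonal, diagonal_mul,
    conjTranspose_apply, Complex.re_sum]
  refine Finset.sum_congr rfl fun i _ => Finset.sum_congr rfl fun j _ => ?_
  rw [Real.exp_add, mul_right_comm _ _ (star (N i j)), mul_assoc _ (N i j), Complex.star_def,
    Complex.mul_conj, Complex.normSq_eq_norm_sq]
  norm_cast
  ring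

/-- The exponential sum representing `∑ₖ tr (x Aₖ y Aₖ†)` on a product of flats. -/
def expSum {n m : ℕ} (A : Fin m → Matrix (Fin n) (Fin n) ℂ) (g h : GL (Fin n) ℂ)
    (α β : Fin n → ℝ) : ℝ :=
  ∑ k, ∑ i, ∑ j, Real.exp (α i + β j) * ‖((g : Matrix (Fin n) (Fin n) ℂ)ᴴ * A k *
    (h : Matrix (Fin n) (Fin n) ℂ)) i j‖ ^ 2

section Recession

variable {n m : ℕ} (A : Fin m → Matrix (Fin n) (Fin n) ℂ)

theorem scalingFun_flat (g h : GL (Fin n) ℂ) (α β : Fin n → ℝ) :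
    scalingFun A (WithLp.toLp 2 (flat g α, flat h β)) = n * Real.log (expSum A g h α β) := by
  change n * Real.log (∑ k, (trace ((flat g α).1 * A k * (flat h β).1 * (A k)ᴴ)).re) = _
  simp only [trace_flat_mul]
  rfl

theorem expSum_mono {g h : GL (Fin n) ℂ} {α β α' β' : Fin n → ℝ} {C : ℝ}
    (hC : ∀ i j, (∃ k, ((g : Matrix (Fin n) (Fin n) ℂ)ᴴ * A k *
      (h : Matrix (Fin n) (Fin n) ℂ)) i j ≠ 0) → α i + β j ≤ C + (α' i + β' j)) :
    expSum A g h α β ≤ Real.exp C * expSum A g h α' β' := by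
  unfold expSum
  simp only [Finset.mul_sum]
  refine Finset.sum_le_sum fun k _ => Finset.sum_le_sum fun i _ => Finset.sum_le_sum fun j _ => ?_
  by_cases h0 : ((g : Matrix (Fin n) (Fin n) ℂ)ᴴ * A k * (h : Matrix (Fin n) (Fin n) ℂ)) i j = 0
  · simp [h0]
  · rw [← mul_assoc, ← Real.exp_add]
    have := hC i j ⟨k, h0⟩
    gcongr

theorem le_expSum (g h : GL (Fin n) ℂ) (α β : Fin n → ℝ) (k : Fin m) (i j : Fin n) :
    Real.exp (α i + β j) * ‖((g : Matrix (Fin n) (Fin n) ℂ)ᴴ * A k *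
      (h : Matrix (Fin n) (Fin n) ℂ)) i j‖ ^ 2 ≤ expSum A g h α β := by
  unfold expSum
  refine le_trans ?_ (Finset.single_le_sum (f := fun k => ∑ i, ∑ j, Real.exp (α i + β j) *
    ‖((g : Matrix (Fin n) (Fin n) ℂ)ᴴ * A k * (h : Matrix (Fin n) (Fin n) ℂ)) i j‖ ^ 2)
    (fun k _ => by positivity) (Finset.mem_univ k))
  refine le_trans ?_ (Finset.single_le_sum (f := fun i => ∑ j, Real.exp (α i + β j) *
    ‖((g : Matrix (Fin n) (Fin n) ℂ)ᴴ * A k * (h : Matrix (Fin n) (Fin n) ℂ)) i j‖ ^ 2)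
    (fun k _ => by positivity) (Finset.mem_univ i))
  exact Finset.single_le_sum (f := fun j => Real.exp (α i + β j) *
    ‖((g : Matrix (Fin n) (Fin n) ℂ)ᴴ * A k * (h : Matrix (Fin n) (Fin n) ℂ)) i j‖ ^ 2)
    (fun k _ => by positivity) (Finset.mem_univ j)

variable {A}

theorem exists_entry_ne_zero (hA : ∃ k, A k ≠ 0) (g h : GL (Fin n) ℂ) :
    ∃ i j k, ((g : Matrix (Fin n) (Fin n) ℂ)ᴴ * A k * (h : Matrix (Fin n) (Fin n) ℂ)) i j ≠ 0 := by
  by_contra! hcon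
  obtain ⟨k, hk⟩ := hA
  apply hk
  have h0 : (g : Matrix (Fin n) (Fin n) ℂ)ᴴ * A k * (h : Matrix (Fin n) (Fin n) ℂ) = 0 := by
    ext i j
    exact hcon i j k
  have hg : IsUnit (g : Matrix (Fin n) (Fin n) ℂ)ᴴ := by
    rw [← star_eq_conjTranspose]
    exact g.isUnit.star
  exact (hg.mul_right_eq_zero).1 ((h.isUnit.mul_left_eq_zero).1 h0)

theorem expSum_pos (hA : ∃ k, A k ≠ 0) (g h : GL (Fin n) ℂ) (α β : Fin n → ℝ) :
    0 < expSum A g h α β := by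
  obtain ⟨i, j, k, hk⟩ := exists_entry_ne_zero hA g h
  refine lt_of_lt_of_le ?_ (le_expSum A g h α β k i j)
  have := norm_pos_iff.2 hk
  positivity

/-- Moving along a geodesic of length `d` in the product changes each coordinate of either exponent
vector by at most `d`, hence each exponent `αᵢ + βⱼ` by at most `2 d`. -/
theorem scalingFun_sub_le (hA : ∃ k, A k ≠ 0) (z z' : PDPair n) :
    scalingFun A z' - scalingFun A z ≤ 2 * n * dist z z' := by
  obtain ⟨x, y⟩ := z
  obtain ⟨x', y'⟩ := z'
  obtain ⟨g, β, rfl, rfl⟩ := exists_flat x x'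
  obtain ⟨h, δ, rfl, rfl⟩ := exists_flat y y'
  have hd := dist_le_l2_dist (flat g 0) (flat g β) (flat h 0) (flat h δ)
  rw [dist_flat_zero, dist_flat_zero] at hd
  set d := dist (WithLp.toLp 2 (flat g 0, flat h 0)) (WithLp.toLp 2 (flat g β, flat h δ))
  have hcoord : ∀ (γ : Fin n → ℝ) i, γ i ≤ √(∑ i, γ i ^ 2) := fun γ i =>
    Real.le_sqrt_of_sq_le (Finset.single_le_sum (f := fun i => γ i ^ 2)
      (fun i _ => sq_nonneg _) (Finset.mem_univ i))
  have hle : expSum A g h β δ ≤ Real.exp (2 * d) * expSum A g h 0 0 := by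
    refine expSum_mono A fun i j _ => ?_
    have := hcoord β i
    have := hcoord δ j
    simp only [Pi.zero_apply]
    linarith [hd.1, hd.2]
  have hlog := Real.log_le_log (expSum_pos hA g h β δ) hle
  rw [Real.log_mul (Real.exp_pos _).ne' (expSum_pos hA g h 0 0).ne', Real.log_exp] at hlog
  rw [scalingFun_flat, scalingFun_flat]
  have hn : (0 : ℝ) ≤ n := Nat.cast_nonneg n
  nlinarith

theorem abs_scalingFun_sub_le (hA : ∃ k, A k ≠ 0) (z z' : PDPair n) :
    |scalingFun A z' - scalingFun A z| ≤ 2 * n * dist z z' := by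
  rw [abs_le]
  constructor
  · have := scalingFun_sub_le hA z' z
    rw [IsPseudoDist.dist_comm] at this
    linarith
  · exact scalingFun_sub_le hA z z'

theorem tendsto_div_of_abs_sub_le {f : ℝ≥0 → ℝ} {L K : ℝ} (h : ∀ t : ℝ≥0, |f t - L * t| ≤ K) :
    Tendsto (fun t : ℝ≥0 => (f t - f 0) / (t : ℝ)) atTop (𝓝 L) := by
  have h1 := BoundaryCone.tendsto_div_of_bounded (u := fun t => f t - f 0 - L * t)
    (K := K + |f 0|) fun t => by
      have : f t - f 0 - L * t = (f t - L * t) - f 0 := by ring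
      rw [this]
      exact (abs_sub _ _).trans (add_le_add (h t) le_rfl)
  have h2 := h1.const_add L
  rw [add_zero] at h2
  refine h2.congr' ?_
  filter_upwards [eventually_gt_atTop 0] with t ht
  have ht' : (0 : ℝ) < t := ht
  field_simp
  ring

/-- A single term with the maximal exponent bounds the sum from below, and replacing all exponents
by `M t` bounds it from above. -/
theorem abs_log_expSum_sub_le (hA : ∃ k, A k ≠ 0) (g h : GL (Fin n) ℂ) {α β : Fin n → ℝ} {M : ℝ}
    (hM : IsGreatest {s : ℝ | ∃ i j, (∃ k, ((g : Matrix (Fin n) (Fin n) ℂ)ᴴ * A k *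
        (h : Matrix (Fin n) (Fin n) ℂ)) i j ≠ 0) ∧ s = α i + β j} M) :
    ∃ K, ∀ t : ℝ≥0, |Real.log (expSum A g h ((t : ℝ) • α) ((t : ℝ) • β)) - M * t| ≤ K := by
  obtain ⟨⟨i, j, ⟨k, hk⟩, rfl⟩, hmax⟩ := hM
  set M := α i + β j
  set w := ‖((g : Matrix (Fin n) (Fin n) ℂ)ᴴ * A k * (h : Matrix (Fin n) (Fin n) ℂ)) i j‖ ^ 2
  have hw : 0 < w := by
    have := norm_pos_iff.2 hk
    positivity
  refine ⟨|Real.log w| + |Real.log (expSum A g h 0 0)|, fun t => ?_⟩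
  have hpos := expSum_pos hA g h ((t : ℝ) • α) ((t : ℝ) • β)
  have hup : expSum A g h ((t : ℝ) • α) ((t : ℝ) • β) ≤ Real.exp (M * t) * expSum A g h 0 0 := by
    refine expSum_mono A fun i j hij => ?_
    have h1 : α i + β j ≤ M := hmax ⟨i, j, hij, rfl⟩
    have ht : (0 : ℝ) ≤ t := t.coe_nonneg
    simp only [Pi.smul_apply, Pi.zero_apply, smul_eq_mul]
    nlinarith
  have hlow : Real.exp (M * t) * w ≤ expSum A g h ((t : ℝ) • α) ((t : ℝ) • β) := by
    have := le_expSum A g h ((t : ℝ) • α) ((t : ℝ) • β) k i j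
    have e : ((t : ℝ) • α) i + ((t : ℝ) • β) j = M * t := by
      simp only [Pi.smul_apply, smul_eq_mul, M]
      ring
    rwa [e] at this
  have l1 := Real.log_le_log hpos hup
  have l2 := Real.log_le_log (by positivity) hlow
  rw [Real.log_mul (Real.exp_pos _).ne' (expSum_pos hA g h 0 0).ne', Real.log_exp] at l1
  rw [Real.log_mul (Real.exp_pos _).ne' hw.ne', Real.log_exp] at l2
  have a1 := le_abs_self (Real.log (expSum A g h 0 0))
  have a2 := neg_abs_le (Real.log w)
  have a3 := abs_nonneg (Real.log (expSum A g h 0 0))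
  have a4 := abs_nonneg (Real.log w)
  rw [abs_le]
  constructor <;> linarith

/-- The recession function of the scaling function. -/
theorem recession_scalingFun (hA : ∃ k, A k ≠ 0) (α β : Fin n → ℝ) (g h : GL (Fin n) ℂ) :
    ∃ M : ℝ,
      IsGreatest {s : ℝ | ∃ i j, (∃ k, ((g : Matrix (Fin n) (Fin n) ℂ)ᴴ * A k *
        (h : Matrix (Fin n) (Fin n) ℂ)) i j ≠ 0) ∧ s = α i + β j} M ∧
      (∀ c : Ray (PDPair n), BoundaryCone.mk c = pairPoint (flagPoint α g) (flagPoint β h) →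
        Tendsto (fun t : ℝ≥0 => (scalingFun A (c t) - scalingFun A (c 0)) / (t : ℝ)) atTop
          (𝓝 (n * M))) ∧
      BoundaryCone.recession (scalingFun A) (pairPoint (flagPoint α g) (flagPoint β h)) =
        ((n * M : ℝ) : EReal) := by
  obtain ⟨i₀, j₀, k₀, h₀⟩ := exists_entry_ne_zero hA g h
  have hfin : {s : ℝ | ∃ i j, (∃ k, ((g : Matrix (Fin n) (Fin n) ℂ)ᴴ * A k *
      (h : Matrix (Fin n) (Fin n) ℂ)) i j ≠ 0) ∧ s = α i + β j}.Finite := by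
    refine (Set.finite_range fun x : Fin n × Fin n => α x.1 + β x.2).subset ?_
    rintro s ⟨i, j, -, rfl⟩
    exact ⟨(i, j), rfl⟩
  obtain ⟨M, hM, hmax⟩ := hfin.exists_maximal ⟨_, i₀, j₀, ⟨k₀, h₀⟩, rfl⟩
  have hgr : IsGreatest {s : ℝ | ∃ i j, (∃ k, ((g : Matrix (Fin n) (Fin n) ℂ)ᴴ * A k *
      (h : Matrix (Fin n) (Fin n) ℂ)) i j ≠ 0) ∧ s = α i + β j} M :=
    ⟨hM, fun s hs => (le_total s M).elim id (hmax hs)⟩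
  have hlim : ∀ c : Ray (PDPair n),
      BoundaryCone.mk c = pairPoint (flagPoint α g) (flagPoint β h) →
      Tendsto (fun t : ℝ≥0 => (scalingFun A (c t) - scalingFun A (c 0)) / (t : ℝ)) atTop
        (𝓝 (n * M)) := by
    intro c hc
    obtain ⟨K, hK⟩ : c.Asymptotic (Ray.pair (ray g α) (ray h β)) := BoundaryCone.mk_eq_mk.1 hc
    obtain ⟨K', hK'⟩ := abs_log_expSum_sub_le hA g h hgr
    refine tendsto_div_of_abs_sub_le (f := fun t => scalingFun A (c t))
      (K := 2 * n * K + n * K') fun t => ?_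
    have h1 : |scalingFun A (c t) - scalingFun A (Ray.pair (ray g α) (ray h β) t)| ≤
        2 * n * K := by
      refine (abs_scalingFun_sub_le hA _ _).trans ?_
      rw [IsPseudoDist.dist_comm]
      exact mul_le_mul_of_nonneg_left (hK t) (by positivity)
    have h2 : |scalingFun A (Ray.pair (ray g α) (ray h β) t) - n * M * t| ≤ n * K' := by
      have e : scalingFun A (Ray.pair (ray g α) (ray h β) t) =
          n * Real.log (expSum A g h ((t : ℝ) • α) ((t : ℝ) • β)) := scalingFun_flat A g h _ _
      rw [e, mul_assoc, ← mul_sub, abs_mul, abs_of_nonneg (Nat.cast_nonneg n)]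
      exact mul_le_mul_of_nonneg_left (hK' t) (Nat.cast_nonneg n)
    exact (abs_sub_le _ _ _).trans (add_le_add h1 h2)
  refine ⟨M, hgr, hlim, ?_⟩
  exact ((continuous_coe_real_ereal.tendsto _).comp (hlim _ (Quot.out_eq _))).limUnder_eq

end Recession

/-! ### The set `B` of the recession function -/

section SetB

variable {n m : ℕ} {A : Fin m → Matrix (Fin n) (Fin n) ℂ}

theorem conj_entry (B : Matrix (Fin n) (Fin n) ℂ) (g h : GL (Fin n) ℂ) (i j : Fin n) :
    ((g : Matrix (Fin n) (Fin n) ℂ)ᴴ * B * (h : Matrix (Fin n) (Fin n) ℂ)) i j =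
      star (fun r => (g : Matrix (Fin n) (Fin n) ℂ) r i) ⬝ᵥ
        (B *ᵥ fun r => (h : Matrix (Fin n) (Fin n) ℂ) r j) := by
  rw [Matrix.mul_assoc]
  rfl

theorem spanCols_mem_annihilatedPairs {g h : GL (Fin n) ℂ} {a b : ℕ}
    (hz : ∀ i j : Fin n, (i : ℕ) < a → (j : ℕ) < b → ∀ k,
      ((g : Matrix (Fin n) (Fin n) ℂ)ᴴ * A k * (h : Matrix (Fin n) (Fin n) ℂ)) i j = 0) :
    (spanCols g a, spanCols h b) ∈ annihilatedPairs A := by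
  intro u hu v hv k
  change u ∈ spanCols g a at hu
  change v ∈ spanCols h b at hv
  induction hu using Submodule.span_induction with
  | mem x hx =>
    obtain ⟨i, hi, rfl⟩ := hx
    induction hv using Submodule.span_induction with
    | mem y hy =>
      obtain ⟨j, hj, rfl⟩ := hy
      rw [← conj_entry]
      exact hz i j hi hj k
    | zero => simp
    | add x y _ _ hx hy => rw [mulVec_add, dotProduct_add, hx, hy, add_zero]
    | smul a x _ hx => rw [mulVec_smul, dotProduct_smul, hx, smul_zero]
  | zero => simp
  | add x y _ _ hx hy => rw [star_add, add_dotProduct, hx, hy, add_zero]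
  | smul a x _ hx => rw [star_smul, smul_dotProduct, hx, smul_zero]

/-- The frame shared with `p` serves `α` and `r • α` at once, because both are antitone. -/
theorem inner_smul_flagPoint {α : Fin n → ℝ} (hα : Antitone α) (g : GL (Fin n) ℂ)
    (p : BoundaryCone (PDMat n)) {r : ℝ} (hr : 0 ≤ r) :
    BoundaryCone.inner (flagPoint (r • α) g) p = r * BoundaryCone.inner (flagPoint α g) p := by
  obtain ⟨k, γ, hk, rfl⟩ := exists_common_frame g p
  rw [hk α hα, hk (r • α) (fun i j hij => mul_le_mul_of_nonneg_left (hα hij) hr),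
    inner_flagPoint, inner_flagPoint, Finset.mul_sum]
  exact Finset.sum_congr rfl fun i _ => by rw [Pi.smul_apply, smul_eq_mul, mul_assoc]

theorem inner_neg_one_flagPoint (g : GL (Fin n) ℂ) (p : BoundaryCone (PDMat n)) :
    BoundaryCone.inner (flagPoint (-1) g) p = -BoundaryCone.inner (subspacePoint ⊤) p := by
  obtain ⟨k, γ, hk, rfl⟩ := exists_common_frame g p
  rw [hk (-1) (fun i j _ => le_rfl), inner_flagPoint, inner_subspacePoint_top]
  simp

theorem inner_zero_flagPoint (g : GL (Fin n) ℂ) (p : BoundaryCone (PDMat n)) :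
    BoundaryCone.inner (flagPoint 0 g) p = 0 := by
  unfold BoundaryCone.inner
  rw [norm_flagPoint]
  simp

/-- Membership in `B` is tested on unit vectors only; positive homogeneity extends the inequality to
all `(α, β)`. Any upper bound `M` of the relevant exponents may replace their maximum. -/
theorem inner_le_of_mem_B (hA : ∃ k, A k ≠ 0) {p q : BoundaryCone (PDMat n)}
    (hB : pairPoint p q ∈ BoundaryCone.B (BoundaryCone.recession (scalingFun A)))
    {α β : Fin n → ℝ} (hα : Antitone α) (hβ : Antitone β) (g h : GL (Fin n) ℂ) {M : ℝ}
    (hM : ∀ i j, (∃ k, ((g : Matrix (Fin n) (Fin n) ℂ)ᴴ * A k *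
      (h : Matrix (Fin n) (Fin n) ℂ)) i j ≠ 0) → α i + β j ≤ M) :
    BoundaryCone.inner (flagPoint α g) p + BoundaryCone.inner (flagPoint β h) q ≤ n * M := by
  have hnn : 0 ≤ ∑ i, α i ^ 2 + ∑ i, β i ^ 2 := by positivity
  set r := √(∑ i, α i ^ 2 + ∑ i, β i ^ 2) with hr
  rcases (Real.sqrt_nonneg (∑ i, α i ^ 2 + ∑ i, β i ^ 2)).eq_or_lt with h0 | hpos
  · have hsum := (Real.sqrt_eq_zero hnn).1 h0.symm
    have hz : ∀ γ : Fin n → ℝ, ∑ i, γ i ^ 2 ≤ 0 → γ = 0 := by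
      intro γ hγ
      have := (Finset.sum_eq_zero_iff_of_nonneg (fun i _ => sq_nonneg (γ i))).1
        (le_antisymm hγ (Finset.sum_nonneg fun i _ => sq_nonneg _))
      ext i
      exact pow_eq_zero_iff (two_ne_zero) |>.1 (this i (Finset.mem_univ i))
    have hα0 := hz α (by linarith [Finset.sum_nonneg fun i (_ : i ∈ Finset.univ) => sq_nonneg (β i)])
    have hβ0 := hz β (by linarith [Finset.sum_nonneg fun i (_ : i ∈ Finset.univ) => sq_nonneg (α i)])
    subst hα0 hβ0
    -- The zero vector cannot be normalised. It does occur, for two zero subspaces; here a nonzero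
    -- entry shows `0 ≤ M`.
    obtain ⟨i, j, k, hk⟩ := exists_entry_ne_zero hA g h
    have := hM i j ⟨k, hk⟩
    rw [inner_zero_flagPoint, inner_zero_flagPoint]
    simp only [Pi.zero_apply, add_zero] at this ⊢
    positivity
  · change 0 < r at hpos
    obtain ⟨M', ⟨⟨i, j, hij, hM'⟩, -⟩, -, hrec⟩ :=
      recession_scalingFun hA (r⁻¹ • α) (r⁻¹ • β) g h
    have hu := hB (pairPoint (flagPoint (r⁻¹ • α) g) (flagPoint (r⁻¹ • β) h)) (by
      rw [norm_pairPoint_flagPoint, Real.sqrt_eq_one]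
      simp only [Pi.smul_apply, smul_eq_mul, mul_pow, ← Finset.mul_sum]
      rw [← mul_add, inv_pow, hr, Real.sq_sqrt hnn]
      refine inv_mul_cancel₀ fun h0 => ?_
      rw [hr, h0, Real.sqrt_zero] at hpos
      exact lt_irrefl _ hpos)
    rw [hrec, EReal.coe_le_coe_iff, inner_pairPoint,
      inner_smul_flagPoint hα g p (inv_nonneg.2 hpos.le),
      inner_smul_flagPoint hβ h q (inv_nonneg.2 hpos.le), ← mul_add, hM'] at hu
    have hle := hM i j hij
    simp only [Pi.smul_apply, smul_eq_mul, ← mul_add] at hu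
    rw [mul_left_comm] at hu
    have h1 := le_of_mul_le_mul_left hu (inv_pos.2 hpos)
    exact h1.trans (mul_le_mul_of_nonneg_left hle (Nat.cast_nonneg n))

/-! ### Layer-cake summation and superlevel sets. -/

theorem integral_indicator_le {a R : ℝ} (ha : |a| ≤ R) :
    IntervalIntegrable (fun s : ℝ => if s ≤ a then (1 : ℝ) else 0) MeasureTheory.volume (-R) R ∧
      ∫ s in (-R)..R, (if s ≤ a then (1 : ℝ) else 0) = a + R := by
  constructor
  · apply Antitone.intervalIntegrable
    intro s t hst
    simp only
    split_ifs with h1 h2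
    · exact le_rfl
    · exact absurd (hst.trans h1) h2
    · exact zero_le_one
    · exact le_rfl
  · have := intervalIntegral.integral_indicator (f := fun _ : ℝ => (1 : ℝ))
      (μ := MeasureTheory.volume) (a₁ := -R) (a₂ := a) (a₃ := R)
      ⟨(abs_le.1 ha).1, (abs_le.1 ha).2⟩
    simp only [Set.indicator, Set.mem_ofPred_eq] at this
    rw [this]
    simp

/-- Layer-cake summation over the pairs of superlevel sets `{i | s ≤ αᵢ}`, `{j | M - s < βⱼ}`. -/
theorem sum_mul_add_sum_mul_le {α β γ δ : Fin n → ℝ} {M N : ℝ} (hγ : ∑ i, γ i = N)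
    (hδ : ∑ j, δ j = N)
    (h : ∀ s : ℝ, (∑ i, if s ≤ α i then γ i else 0) + (∑ j, if M - s < β j then δ j else 0) ≤ N) :
    ∑ i, α i * γ i + ∑ j, β j * δ j ≤ N * M := by
  set R := ∑ i, |α i| + ∑ j, |M - β j| with hR
  have hα : ∀ i, |α i| ≤ R := fun i => by
    have h1 := Finset.single_le_sum (f := fun i => |α i|) (fun i _ => abs_nonneg _)
      (Finset.mem_univ i)
    have h2 : 0 ≤ ∑ j, |M - β j| := Finset.sum_nonneg fun j _ => abs_nonneg _
    linarith
  have hβ : ∀ j, |M - β j| ≤ R := fun j => by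
    have h1 := Finset.single_le_sum (f := fun j => |M - β j|) (fun i _ => abs_nonneg _)
      (Finset.mem_univ j)
    have h2 : 0 ≤ ∑ i, |α i| := Finset.sum_nonneg fun j _ => abs_nonneg _
    linarith
  have hR0 : 0 ≤ R := by positivity
  have e1 : ∀ s, (∑ i, if s ≤ α i then γ i else 0) =
      ∑ i, γ i * (if s ≤ α i then 1 else 0) := fun s =>
    Finset.sum_congr rfl fun i _ => by split_ifs <;> simp
  -- The strict inequality is the exact complement of `s ≤ M - βⱼ`, so both sums are integrated by
  -- the same indicator formula.
  have e2 : ∀ s, (∑ j, if M - s < β j then δ j else 0) =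
      ∑ j, δ j * (1 - if s ≤ M - β j then 1 else 0) := fun s =>
    Finset.sum_congr rfl fun j _ => by
      by_cases hs : s ≤ M - β j
      · rw [if_neg (by linarith), if_pos hs]; ring
      · rw [if_pos (by linarith), if_neg hs]; ring
  have i1 : ∀ i, IntervalIntegrable (fun s : ℝ => γ i * (if s ≤ α i then 1 else 0))
      MeasureTheory.volume (-R) R := fun i =>
    (integral_indicator_le (hα i)).1.const_mul _
  have i2 : ∀ j, IntervalIntegrable (fun s : ℝ => δ j * (1 - if s ≤ M - β j then 1 else 0))
      MeasureTheory.volume (-R) R := fun j =>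
    (intervalIntegrable_const.sub (integral_indicator_le (hβ j)).1).const_mul _
  have i3 : IntervalIntegrable (fun s : ℝ => ∑ i, γ i * (if s ≤ α i then 1 else 0))
      MeasureTheory.volume (-R) R := by
    simpa only [Finset.sum_fn] using IntervalIntegrable.sum Finset.univ fun i _ => i1 i
  have i4 : IntervalIntegrable (fun s : ℝ => ∑ j, δ j * (1 - if s ≤ M - β j then 1 else 0))
      MeasureTheory.volume (-R) R := by
    simpa only [Finset.sum_fn] using IntervalIntegrable.sum Finset.univ fun j _ => i2 j
  -- All thresholds lie in `[-R, R]`, so each `αᵢ` and `βⱼ` is recovered from an integral; the terms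
  -- in `R` cancel since both weights have total `N`.
  have key : ∫ s in (-R)..R, ((∑ i, γ i * (if s ≤ α i then 1 else 0)) +
      ∑ j, δ j * (1 - if s ≤ M - β j then 1 else 0)) ≤ ∫ _s in (-R)..R, N := by
    refine intervalIntegral.integral_mono_on (by linarith) ?_ intervalIntegrable_const
      fun s _ => ?_
    · exact i3.add i4
    · rw [← e1, ← e2]
      exact h s
  rw [intervalIntegral.integral_add, intervalIntegral.integral_finsetSum fun i _ => i1 i,
    intervalIntegral.integral_finsetSum fun j _ => i2 j] at key
  · simp only [intervalIntegral.integral_const_mul, (integral_indicator_le (hα _)).2,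
      intervalIntegral.integral_sub intervalIntegrable_const (integral_indicator_le (hβ _)).1,
      (integral_indicator_le (hβ _)).2, intervalIntegral.integral_const, smul_eq_mul] at key
    have k1 : ∑ i, γ i * (α i + R) = ∑ i, α i * γ i + N * R := by
      rw [← hγ, Finset.sum_mul, ← Finset.sum_add_distrib]
      exact Finset.sum_congr rfl fun i _ => by ring
    have k2 : ∑ j, δ j * ((R - -R) * 1 - (M - β j + R)) =
        ∑ j, β j * δ j + N * (R - M) := by
      rw [← hδ, Finset.sum_mul, ← Finset.sum_add_distrib]
      exact Finset.sum_congr rfl fun i _ => by ring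
    rw [k1, k2] at key
    linarith
  · exact i3
  · exact i4

/-- The bound `k` is the first index at which `P` fails. A general upward closed `P` covers the weak
threshold used for `α` and the strict one used for `β`. -/
theorem antitone_superlevel {α : Fin n → ℝ} (P : ℝ → Prop) (hP : ∀ x y, x ≤ y → P x → P y)
    (hα : Antitone α) : ∃ k ≤ n, ∀ i : Fin n, P (α i) ↔ (i : ℕ) < k := by
  classical
  by_cases hall : ∀ i, P (α i)
  · exact ⟨n, le_rfl, fun i => ⟨fun _ => i.2, fun _ => hall i⟩⟩
  · push Not at hall
    obtain ⟨k, hk, hmin⟩ := (Set.toFinite {i | ¬ P (α i)}).exists_minimal hall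
    refine ⟨k, k.2.le, fun i => ⟨fun hi => ?_, fun hi => ?_⟩⟩
    · by_contra hlt
      exact hk (hP _ _ (hα (not_lt.1 hlt)) hi)
    · by_contra hni
      have h1 : k ≤ i := hmin hni (le_of_lt hi)
      exact absurd hi (not_lt.2 h1)

end SetB

end

/-! ### The main theorem. -/

theorem mainTheorem7 {n m : ℕ} (A : Fin m → Matrix (Fin n) (Fin n) ℂ) (hA : ∃ k, A k ≠ 0) :
    -- the identification `C(P_n × P_n)^∞ = C P_n^∞ × C P_n^∞`
    Function.Bijective (fun z : BoundaryCone (PDMat n) × BoundaryCone (PDMat n) =>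
      pairPoint z.1 z.2) ∧
    -- the recession function
    (∀ (α β : Fin n → ℝ) (g h : GL (Fin n) ℂ), ∃ M : ℝ,
      IsGreatest {s : ℝ | ∃ i j, (∃ k, ((g : Matrix (Fin n) (Fin n) ℂ)ᴴ * A k *
        (h : Matrix (Fin n) (Fin n) ℂ)) i j ≠ 0) ∧ s = α i + β j} M ∧
      (∀ c : Ray (PDPair n), BoundaryCone.mk c = pairPoint (flagPoint α g) (flagPoint β h) →
        Tendsto (fun t : ℝ≥0 => (scalingFun A (c t) - scalingFun A (c 0)) / (t : ℝ)) atTop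
          (𝓝 (n * M))) ∧
      BoundaryCone.recession (scalingFun A) (pairPoint (flagPoint α g) (flagPoint β h)) =
        ((n * M : ℝ) : EReal)) ∧
    -- the set `B(f_A^∞)`
    (∀ p q : BoundaryCone (PDMat n), pairPoint p q ∈ BoundaryCone.B (BoundaryCone.recession (scalingFun A)) ↔
      BoundaryCone.inner (subspacePoint ⊤) p = n ∧ BoundaryCone.inner (subspacePoint ⊤) q = n ∧
      ∀ X Y, (X, Y) ∈ annihilatedPairs A →
        BoundaryCone.inner (subspacePoint X) p + BoundaryCone.inner (subspacePoint Y) q ≤ n) := by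
  refine ⟨pairPoint_bijective, recession_scalingFun hA, fun p q => ⟨fun hB => ?_, ?_⟩⟩
  · have hconst : ∀ c : ℝ, Antitone fun _ : Fin n => c := fun c i j _ => le_rfl
    have htop : ∀ r : BoundaryCone (PDMat n),
        BoundaryCone.inner (flagPoint 1 1) r = BoundaryCone.inner (subspacePoint ⊤) r := fun r => by
      rw [← subspacePoint_top]
    -- Along the central directions `±(1,…,1)` all exponents are equal to `±1`, so the two opposite
    -- inequalities give an equation.
    have p1 := inner_le_of_mem_B hA hB (α := 1) (β := 0) (hconst 1) (hconst 0) 1 1 (M := 1)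
      (fun i j _ => by simp)
    have p2 := inner_le_of_mem_B hA hB (α := -1) (β := 0) (hconst (-1)) (hconst 0) 1 1 (M := -1)
      (fun i j _ => by simp)
    have q1 := inner_le_of_mem_B hA hB (α := 0) (β := 1) (hconst 0) (hconst 1) 1 1 (M := 1)
      (fun i j _ => by simp)
    have q2 := inner_le_of_mem_B hA hB (α := 0) (β := -1) (hconst 0) (hconst (-1)) 1 1 (M := -1)
      (fun i j _ => by simp)
    rw [htop, inner_zero_flagPoint] at p1 q1
    rw [inner_neg_one_flagPoint, inner_zero_flagPoint] at p2 q2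
    refine ⟨by linarith, by linarith, fun X Y hXY => ?_⟩
    have hanti : ∀ k : ℕ, Antitone fun i : Fin n => if (i : ℕ) < k then (1 : ℝ) else 0 := by
      intro k i j hij
      have hij' : (i : ℕ) ≤ j := hij
      simp only
      split_ifs with h1 h2
      · exact le_rfl
      · omega
      · exact zero_le_one
      · exact le_rfl
    -- An exponent `2` could only come from an entry with both indices in the leading range, and
    -- these entries vanish because `(X, Y)` is an annihilated pair.
    have := inner_le_of_mem_B hA hB (hanti (Module.finrank ℂ X)) (hanti (Module.finrank ℂ Y))
      (exists_adapted X).choose (exists_adapted Y).choose (M := 1) fun i j ⟨k, hk⟩ => by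
        by_cases hi : (i : ℕ) < Module.finrank ℂ X
        · by_cases hj : (j : ℕ) < Module.finrank ℂ Y
          · exfalso
            apply hk
            rw [conj_entry]
            refine hXY _ ?_ _ ?_ k
            · exact (exists_adapted X).choose_spec.le (Submodule.subset_span ⟨i, hi, rfl⟩)
            · exact (exists_adapted Y).choose_spec.le (Submodule.subset_span ⟨j, hj, rfl⟩)
          · rw [if_pos hi, if_neg hj, add_zero]
        · rw [if_neg hi]
          split_ifs <;> norm_num
    rw [mul_one] at this
    exact this
  · rintro ⟨hp, hq, hS⟩ u hu
    obtain ⟨⟨u₁, u₂⟩, rfl⟩ := pairPoint_bijective.2 u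
    obtain ⟨α, g', hα, rfl⟩ := exists_antitone_flagPoint u₁
    obtain ⟨β, h', hβ, rfl⟩ := exists_antitone_flagPoint u₂
    -- The frame of the test direction is replaced by one shared with the point to be tested, so
    -- that both are given by coordinates in the same flat.
    obtain ⟨g, γ, hg, rfl⟩ := exists_common_frame g' p
    obtain ⟨h, δ, hh, rfl⟩ := exists_common_frame h' q
    simp only [hg α hα, hh β hβ]
    obtain ⟨M, ⟨-, hM⟩, -, hrec⟩ := recession_scalingFun hA α β g h
    rw [hrec, EReal.coe_le_coe_iff, inner_pairPoint, inner_flagPoint, inner_flagPoint]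
    rw [inner_subspacePoint_top] at hp hq
    refine sum_mul_add_sum_mul_le hp hq fun s => ?_
    obtain ⟨a, ha, ha'⟩ := antitone_superlevel (fun x => s ≤ x) (fun x y hxy h => h.trans hxy) hα
    obtain ⟨b, hb, hb'⟩ := antitone_superlevel (fun x => M - s < x)
      (fun x y hxy h => h.trans_le hxy) hβ
    -- For `αᵢ ≥ s` and `βⱼ > M - s` the exponent exceeds the maximum `M`, so the entry is zero; one
    -- of the two thresholds has to be strict.
    have key := hS (spanCols g a) (spanCols h b) (spanCols_mem_annihilatedPairs fun i j hi hj k => by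
      by_contra hne
      have h1 : α i + β j ≤ M := hM ⟨i, j, ⟨k, hne⟩, rfl⟩
      have h2 := (ha' i).2 hi
      have h3 := (hb' j).2 hj
      linarith)
    rw [inner_subspacePoint_spanCols g γ ha, inner_subspacePoint_spanCols h δ hb] at key
    simp only [← ha', ← hb'] at key
    exact key
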